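/- Consider the $n$-round partial commitment repeated sales game: a buyer's private value $v$ is drawn once from $U[0,1]$; in each of the $n$ rounds the seller posts a non-negative price for a fresh copy of a perishable item (production cost $0$), which may not exceed any price that the buyer accepted in an earlier round, and the buyer accepts or rejects; utilities are quasilinear and undiscounted. A perfect Bayesian equilibrium (PBE) consists of a seller strategy, a buyer strategy and beliefs of the seller about $v$ after every history, starting from $U[0,1]$, such that the beliefs follow Bayes' rule after every reaction of the buyer that has positive probability, and after every history the seller's strategy (given his belief) and the strategy of every type of the buyer are best responses to each other; it is a threshold PBE if, after every history and posted price, the buyer accepts exactly when $v$ is at least a deterministic threshold. Let $R_0=0$ and $R_n=\dfrac{(1+2R_{n-1})^2}{4(1+R_{n-1})}$ for $n\ge 1$. Then for every $n\ge 1$ the game has a threshold PBE whose expected revenue is $R_n$, and $$R_n=\sqrt{\frac n2+\frac{\log n}{8}+O(1)}\;-\;1 .$$ Moreover these equilibria can be chosen such that the seller posts a deterministic first-round price $p_n$ with $p_n\sim\sqrt{2/n}$, and the buyer's first-round threshold $t_n$ at this price satisfies $1-t_n\sim \frac{1}{\sqrt{2n}}$, as $n\to\infty$. -/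

import Mathlib

open MeasureTheory ProbabilityTheory Filter Asymptotics
open scoped NNReal ENNReal Topology

namespace RepeatedSales

/-- A history of `k` completed rounds: for every round, the posted (non-negative) price and the
buyer's reaction (`true` = accept, `false` = reject). -/
abbrev Hist (k : ℕ) : Type := Fin k → ℝ≥0 × Bool

/-- The history before the first round. -/
def Hist.root : Hist 0 := Fin.elim0

/-- The history `h` followed by one more round with price `p` and reaction `b`. -/
def Hist.extend {k : ℕ} (h : Hist k) (p : ℝ≥0) (b : Bool) : Hist (k + 1) := Fin.snoc h (p, b)

/-- Partial commitment: after `h` the seller may post `p` only if `p` does not exceed any price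
that was accepted in `h`. -/
def Allowed {k : ℕ} (h : Hist k) (p : ℝ≥0) : Prop := ∀ i, (h i).2 = true → p ≤ (h i).1

/-- The histories that can occur in the partial commitment game: no price is higher than a price
that was accepted before. -/
def Legal {k : ℕ} (h : Hist k) : Prop := ∀ i j, i < j → (h i).2 = true → (h j).1 ≤ (h i).1

/-- A (behavioural, possibly randomized) strategy of the seller in the partial commitment game:
for every history a probability distribution over the non-negative prices that the seller may
post, measurable in the history. -/
structure SellerStrategy where
  price : ∀ k, Kernel (Hist k) ℝ≥0
  markov : ∀ k, IsMarkovKernel (price k)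
  noRaise : ∀ k (h : Hist k), ∀ᵐ p ∂(price k h), Allowed h p

/-- A (behavioural, possibly randomized) strategy of the buyer: `accept k v h p` is the
probability with which the buyer of value `v` accepts the price `p` posted after `h`. -/
structure BuyerStrategy where
  accept : ∀ k, ℝ → Hist k → ℝ≥0 → ℝ≥0∞
  accept_le_one : ∀ k v h p, accept k v h p ≤ 1
  measurable_accept : ∀ k,
    Measurable (fun x : ℝ × Hist k × ℝ≥0 => accept k x.1 x.2.1 x.2.2)

/-- The probability of the reaction `b` of the buyer of value `v` to the price `p` after `h`. -/
def BuyerStrategy.prob (B : BuyerStrategy) {k : ℕ} (b : Bool) (v : ℝ) (h : Hist k) (p : ℝ≥0) :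
    ℝ≥0∞ :=
  if b then B.accept k v h p else 1 - B.accept k v h p

/-- The seller's beliefs about the buyer's value, after every history of completed rounds (the
seller learns nothing from the price that he posts himself). -/
abbrev BeliefSystem : Type := ∀ k, Hist k → Measure ℝ

/-- Expected total from a node at which the price `p` has just been posted after `h`, if every
accepted price `q` counts `w q` and `cont` is the expected total from the next round on. -/
noncomputable def respond (B : BuyerStrategy) (w : ℝ≥0 → ℝ≥0∞) (v : ℝ) {k : ℕ}
    (cont : Hist (k + 1) → ℝ≥0∞) (h : Hist k) (p : ℝ≥0) : ℝ≥0∞ :=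
  B.prob true v h p * (w p + cont (h.extend p true)) +
    B.prob false v h p * cont (h.extend p false)

/-- Expected total over the `m` rounds that follow `h`, if the buyer has value `v` and every
accepted price `q` counts `w q`. -/
noncomputable def total (S : SellerStrategy) (B : BuyerStrategy) (w : ℝ≥0 → ℝ≥0∞) (v : ℝ) :
    (m : ℕ) → {k : ℕ} → Hist k → ℝ≥0∞
  | 0, _, _ => 0
  | m + 1, k, h => ∫⁻ p, respond B w v (total S B w v m) h p ∂(S.price k h)

/-- The price itself as a weight: `total` is then the expected payment. -/
def pay (q : ℝ≥0) : ℝ≥0∞ := q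

/-- The seller's expected utility (revenue) in the `m` rounds that follow `h`, when the buyer's
value is distributed according to `μ`. -/
noncomputable def sellerUtility (S : SellerStrategy) (B : BuyerStrategy) (μ : Measure ℝ) (m : ℕ)
    {k : ℕ} (h : Hist k) : ℝ≥0∞ :=
  ∫⁻ v, total S B pay v m h ∂μ

/-- The same from the node at which the price `p` has just been posted after `h`, with `m` rounds
to follow the current one. -/
noncomputable def sellerUtilityMid (S : SellerStrategy) (B : BuyerStrategy) (μ : Measure ℝ)
    (m : ℕ) {k : ℕ} (h : Hist k) (p : ℝ≥0) : ℝ≥0∞ :=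
  ∫⁻ v, respond B pay v (total S B pay v m) h p ∂μ

/-- The expected utility of the buyer of value `v ≥ 0` in the `m` rounds that follow `h`: expected
value of the items bought (a finite number) minus expected payment (possibly infinite). -/
noncomputable def buyerUtility (S : SellerStrategy) (B : BuyerStrategy) (v : ℝ) (m : ℕ)
    {k : ℕ} (h : Hist k) : EReal :=
  (total S B (fun _ => ENNReal.ofReal v) v m h : EReal) - (total S B pay v m h : EReal)

/-- The same from the node at which the price `p` has just been posted after `h`, with `m` rounds
to follow the current one. -/
noncomputable def buyerUtilityMid (S : SellerStrategy) (B : BuyerStrategy) (v : ℝ) (m : ℕ)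
    {k : ℕ} (h : Hist k) (p : ℝ≥0) : EReal :=
  (respond B (fun _ => ENNReal.ofReal v) v (total S B (fun _ => ENNReal.ofReal v) v m) h p : EReal)
    - (respond B pay v (total S B pay v m) h p : EReal)

/-- Perfect Bayesian equilibrium of the `n`-round partial commitment repeated sales game in which
the buyer's value is drawn from `F` on the set `T` of (non-negative) values. -/
structure IsPBE (n : ℕ) (T : Set ℝ) (F : Measure ℝ)
    (S : SellerStrategy) (B : BuyerStrategy) (μ : BeliefSystem) : Prop where
  /-- beliefs are probability distributions on the set of values -/
  belief_prob : ∀ k ≤ n, ∀ h : Hist k, Legal h → IsProbabilityMeasure (μ k h) ∧ μ k h Tᶜ = 0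
  /-- the seller starts with the prior -/
  belief_root : μ 0 Hist.root = F
  /-- Bayes' rule, whenever the buyer's reaction has positive probability -/
  bayes : ∀ k < n, ∀ h : Hist k, Legal h → ∀ p, Allowed h p → ∀ b : Bool,
    (∫⁻ v, B.prob b v h p ∂(μ k h)) ≠ 0 →
      μ (k + 1) (h.extend p b) =
        (∫⁻ v, B.prob b v h p ∂(μ k h))⁻¹ • (μ k h).withDensity (fun v => B.prob b v h p)
  /-- the seller best responds at the beginning of every round -/
  seller_opt : ∀ k < n, ∀ h : Hist k, Legal h → ∀ S' : SellerStrategy,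
    sellerUtility S' B (μ k h) (n - k) h ≤ sellerUtility S B (μ k h) (n - k) h
  /-- the seller's continuation strategy is a best response after every posted price -/
  seller_opt_mid : ∀ k < n, ∀ h : Hist k, Legal h → ∀ p, Allowed h p → ∀ S' : SellerStrategy,
    sellerUtilityMid S' B (μ k h) (n - (k + 1)) h p ≤
      sellerUtilityMid S B (μ k h) (n - (k + 1)) h p
  /-- every type of the buyer best responds at the beginning of every round -/
  buyer_opt : ∀ k < n, ∀ h : Hist k, Legal h → ∀ v ∈ T, ∀ B' : BuyerStrategy,
    buyerUtility S B' v (n - k) h ≤ buyerUtility S B v (n - k) h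
  /-- every type of the buyer best responds after every posted price -/
  buyer_opt_mid : ∀ k < n, ∀ h : Hist k, Legal h → ∀ p, Allowed h p → ∀ v ∈ T,
    ∀ B' : BuyerStrategy,
      buyerUtilityMid S B' v (n - (k + 1)) h p ≤ buyerUtilityMid S B v (n - (k + 1)) h p

/-- `B` is the threshold strategy with the (non-negative) thresholds `t`: after `h`, the price `p`
is accepted exactly by the values that are at least `t k h p`. -/
def IsThreshold (B : BuyerStrategy) (t : ∀ k, Hist k → ℝ≥0 → ℝ≥0) : Prop :=
  ∀ k v (h : Hist k) p, B.accept k v h p = if (t k h p : ℝ) ≤ v then 1 else 0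

/-- The uniform distribution on `[0,1]`. -/
noncomputable def unif : Measure ℝ := volume.restrict (Set.Icc 0 1)

end RepeatedSales

open RepeatedSales

/-!
Before the first sale the seller's belief is uniform on some `[0, b]`. The types that accept a price
`p` are those above a threshold `t`, and after the first sale the price stays at `p`, so that every
buyer who accepted it buys all remaining items. By scaling, the revenue with `m` rounds against the
uniform distribution on `[0, b]` is `b * R m`. If `m` rounds follow, the indifference of `t` gives
`(m + 1) * p = t * (1 + 2 * R m)`, and the expected revenue, as a function of `t`, is a concave
quadratic whose maximum yields the recursion. The utility of the buyer solves the Bellman equation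
of the game and, until the first sale, grows at rate at most `m` in his value, while accepting earns
at rate `m + 1`; hence the threshold strategy is optimal.

The squares `x n = (1 + R n) ^ 2` satisfy `x (n + 1) = x n + 1 / 2 + 1 / (16 * x n)`. Since `x n` is
about `n / 2`, the last terms are about `1 / (8 * n)` and sum to `log n / 8` up to a bounded error.
-/

namespace RepeatedSales

/-! ### Histories -/

section Histories

variable {k : ℕ} (h : Hist k) (p : ℝ≥0) (b : Bool) (a : ℝ≥0)

@[simp] lemma Hist.init_extend : (Fin.init (h.extend p b) : Hist k) = h :=
  Fin.init_snoc (α := fun _ => ℝ≥0 × Bool) _ _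

@[simp] lemma Hist.extend_last : h.extend p b (Fin.last k) = (p, b) :=
  Fin.snoc_last (α := fun _ => ℝ≥0 × Bool) _ _

@[simp] lemma Hist.extend_castSucc (i : Fin k) : h.extend p b i.castSucc = h i :=
  Fin.snoc_castSucc (α := fun _ => ℝ≥0 × Bool) _ _ i

@[elab_as_elim] lemma Hist.induction {motive : ∀ k, Hist k → Prop} (root : motive 0 Hist.root)
    (extend : ∀ k (h : Hist k) p b, motive k h → motive (k + 1) (h.extend p b)) {k : ℕ}
    (h : Hist k) : motive k h :=
  Fin.snocInduction (motive := fun {k} h => motive k h) root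
    (fun h x => extend _ h x.1 x.2) h

/-- Some item has already been sold: the price of the later rounds is then capped. -/
def Hist.Sold (h : Hist k) : Prop := ∃ i, (h i).2 = true

instance : Decidable h.Sold := inferInstanceAs (Decidable (∃ i, (h i).2 = true))

@[simp] lemma Hist.not_sold_root : ¬ Hist.root.Sold := fun ⟨i, _⟩ => i.elim0

@[simp] lemma Hist.sold_extend : (h.extend p b).Sold ↔ h.Sold ∨ b = true := by
  simp [Hist.Sold, Fin.exists_fin_succ']

lemma allowed_extend (q : ℝ≥0) :
    Allowed (h.extend p b) q ↔ Allowed h q ∧ (b = true → q ≤ p) := by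
  simp [Allowed, Fin.forall_fin_succ']

variable {h} in
lemma allowed_of_not_sold (hs : ¬ h.Sold) (q : ℝ≥0) : Allowed h q :=
  fun i hi => (hs ⟨i, hi⟩).elim

/-- The highest price up to `a` that the seller may still post: the minimum of `a` and of the
accepted prices. -/
noncomputable def Hist.priceCap (h : Hist k) : ℝ≥0 :=
  (Finset.univ.filter fun i => (h i).2 = true).fold min a fun i => (h i).1

lemma Hist.le_priceCap_iff {q : ℝ≥0} : q ≤ h.priceCap a ↔ q ≤ a ∧ Allowed h q := by
  simp [Hist.priceCap, Finset.le_fold_min, Allowed]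

lemma Hist.priceCap_le : h.priceCap a ≤ a := ((h.le_priceCap_iff a).1 le_rfl).1

lemma allowed_priceCap : Allowed h (h.priceCap a) := ((h.le_priceCap_iff a).1 le_rfl).2

variable {h} in
lemma Hist.priceCap_of_not_sold (hs : ¬ h.Sold) : h.priceCap a = a :=
  eq_of_forall_le_iff fun q => by simp [le_priceCap_iff, allowed_of_not_sold hs]

@[simp] lemma Hist.priceCap_extend_true :
    (h.extend p true).priceCap a = min (h.priceCap a) p :=
  eq_of_forall_le_iff fun q => by simp [le_priceCap_iff, allowed_extend, and_assoc]

@[simp] lemma Hist.priceCap_extend_false : (h.extend p false).priceCap a = h.priceCap a :=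
  eq_of_forall_le_iff fun q => by simp [le_priceCap_iff, allowed_extend]

lemma Hist.priceCap_extend_le : (h.extend p b).priceCap a ≤ h.priceCap a := by
  cases b <;> simp

end Histories

/-! ### Expected totals -/

section Measurability

variable {k : ℕ}

@[fun_prop] lemma measurable_extend (b : Bool) :
    Measurable fun x : Hist k × ℝ≥0 => x.1.extend x.2 b := by
  refine measurable_pi_lambda _ fun i => ?_
  induction i using Fin.lastCases with
  | last => simp only [Hist.extend_last]; fun_prop
  | cast i => simp only [Hist.extend_castSucc]; fun_prop

lemma measurable_prob (B : BuyerStrategy) (b : Bool) :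
    Measurable fun x : ℝ × Hist k × ℝ≥0 => B.prob b x.1 x.2.1 x.2.2 := by
  cases b
  · simpa [BuyerStrategy.prob] using (B.measurable_accept k).const_sub 1
  · simpa [BuyerStrategy.prob] using B.measurable_accept k

lemma measurable_respond (B : BuyerStrategy) {w : ℝ≥0 → ℝ≥0∞} (hw : Measurable w)
    {F : ℝ → Hist (k + 1) → ℝ≥0∞} (hF : Measurable fun x : ℝ × Hist (k + 1) => F x.1 x.2) :
    Measurable fun x : ℝ × Hist k × ℝ≥0 => respond B w x.1 (F x.1) x.2.1 x.2.2 := by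
  have hF_extend (b : Bool) :
      Measurable fun x : ℝ × Hist k × ℝ≥0 => F x.1 (x.2.1.extend x.2.2 b) :=
    hF.comp (measurable_fst.prodMk ((measurable_extend b).comp measurable_snd))
  have hw_price : Measurable fun x : ℝ × Hist k × ℝ≥0 => w x.2.2 :=
    hw.comp (measurable_snd.comp measurable_snd)
  exact ((measurable_prob B true).mul (hw_price.add (hF_extend true))).add
    ((measurable_prob B false).mul (hF_extend false))

lemma measurable_total (S : SellerStrategy) (B : BuyerStrategy) {w : ℝ≥0 → ℝ≥0∞}
    (hw : Measurable w) (m : ℕ) :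
    Measurable fun x : ℝ × Hist k => total S B w x.1 m x.2 := by
  induction m generalizing k with
  | zero => exact measurable_const
  | succ m ih =>
    have := S.markov k
    have h := (measurable_respond B hw (F := fun v => total S B w v m) ih).comp
      (MeasurableEquiv.prodAssoc (α := ℝ) (β := Hist k) (γ := ℝ≥0)).measurable
    exact Measurable.lintegral_kernel_prod_right'
      (κ := (S.price k).comap Prod.snd (measurable_snd (α := ℝ))) h

lemma measurable_pay : Measurable pay := measurable_coe_nnreal_ennreal

end Measurability

lemma prob_true_add_prob_false (B : BuyerStrategy) {k : ℕ} (v : ℝ) (h : Hist k) (p : ℝ≥0) :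
    B.prob true v h p + B.prob false v h p = 1 := by
  simpa [BuyerStrategy.prob] using add_tsub_cancel_of_le (B.accept_le_one k v h p)

lemma total_succ_of_price_eq_dirac {S : SellerStrategy} {k : ℕ} {h : Hist k} {p : ℝ≥0}
    (hS : S.price k h = Measure.dirac p) (B : BuyerStrategy) (w : ℝ≥0 → ℝ≥0∞) (v : ℝ) (m : ℕ) :
    total S B w v (m + 1) h = respond B w v (total S B w v m) h p := by
  rw [total, hS, lintegral_dirac]

/-! ### Threshold strategies -/

lemma Icc_inter_Iio_ae_eq (b t : ℝ) :
    (Set.Icc 0 b ∩ Set.Iio t : Set ℝ) =ᵐ[volume] Set.Icc 0 (min b t) := by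
  have h_Iic : Set.Icc 0 (min b t) = Set.Icc 0 b ∩ Set.Iic t := by
    ext v
    simp [and_assoc]
  rw [h_Iic]
  exact (ae_eq_refl _).inter Iio_ae_eq_Iic

namespace IsThreshold

variable {B : BuyerStrategy} {t : ∀ k, Hist k → ℝ≥0 → ℝ≥0} {k : ℕ}

lemma prob_true (hB : IsThreshold B t) (h : Hist k) (p : ℝ≥0) :
    (fun v => B.prob true v h p) = (Set.Ici (t k h p : ℝ)).indicator 1 := by
  ext v
  simp [BuyerStrategy.prob, hB k v h p, Set.indicator_apply]

lemma prob_false (hB : IsThreshold B t) (h : Hist k) (p : ℝ≥0) :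
    (fun v => B.prob false v h p) = (Set.Iio (t k h p : ℝ)).indicator 1 := by
  ext v
  by_cases hv : (t k h p : ℝ) ≤ v <;>
    simp [BuyerStrategy.prob, hB k v h p, Set.indicator_apply, hv]

lemma respond_of_le (hB : IsThreshold B t) {h : Hist k} {p : ℝ≥0} {v : ℝ} (hv : t k h p ≤ v)
    (w : ℝ≥0 → ℝ≥0∞) (c : Hist (k + 1) → ℝ≥0∞) :
    respond B w v c h p = w p + c (h.extend p true) := by
  simp [respond, BuyerStrategy.prob, hB k v h p, hv]

lemma respond_of_lt (hB : IsThreshold B t) {h : Hist k} {p : ℝ≥0} {v : ℝ} (hv : v < t k h p)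
    (w : ℝ≥0 → ℝ≥0∞) (c : Hist (k + 1) → ℝ≥0∞) :
    respond B w v c h p = c (h.extend p false) := by
  simp [respond, BuyerStrategy.prob, hB k v h p, hv.not_ge]

lemma lintegral_respond (hB : IsThreshold B t) (w : ℝ≥0 → ℝ≥0∞)
    (F : ℝ → Hist (k + 1) → ℝ≥0∞) (h : Hist k) (p b : ℝ≥0) :
    ∫⁻ v in Set.Icc (0 : ℝ) b, respond B w v (F v) h p =
      (∫⁻ v in Set.Icc (t k h p : ℝ) b, (w p + F v (h.extend p true))) +
        ∫⁻ v in Set.Icc (0 : ℝ) (min b (t k h p)), F v (h.extend p false) := by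
  have h_accept : Set.Icc (0 : ℝ) b ∩ Set.Ici (t k h p : ℝ) = Set.Icc (t k h p : ℝ) b := by
    ext v
    exact ⟨fun hv => ⟨hv.2, hv.1.2⟩, fun hv => ⟨⟨(NNReal.coe_nonneg _).trans hv.1, hv.2⟩, hv.1⟩⟩
  have h_reject : (Set.Icc (0 : ℝ) b \ Set.Ici (t k h p : ℝ) : Set ℝ) =ᵐ[volume]
      Set.Icc (0 : ℝ) (min b (t k h p)) := by
    rw [Set.sdiff_eq, Set.compl_Ici]
    exact Icc_inter_Iio_ae_eq _ _
  rw [← lintegral_inter_add_sdiff _ _ (measurableSet_Ici (a := (t k h p : ℝ))), h_accept,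
    ← setLIntegral_congr h_reject]
  congr 1
  · exact setLIntegral_congr_fun measurableSet_Icc fun v hv => hB.respond_of_le hv.1 _ _
  · exact setLIntegral_congr_fun (measurableSet_Icc.diff measurableSet_Ici)
      fun v hv => hB.respond_of_lt (not_le.1 hv.2) _ _

/-- If the thresholds are never below the price, then a type `v ≤ a` only buys at prices up to
`a`; by partial commitment, no such price exceeds the cap. -/
lemma total_pay_le (hB : IsThreshold B t) (ht : ∀ k h p, p ≤ t k h p) (S : SellerStrategy)
    {v : ℝ} {a : ℝ≥0} (hv : v ≤ a) (m : ℕ) (h : Hist k) :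
    total S B pay v m h ≤ m * h.priceCap a := by
  induction m generalizing k with
  | zero => simp [total]
  | succ m ih =>
    have := S.markov k
    have h_respond : ∀ᵐ p ∂S.price k h,
        respond B pay v (total S B pay v m) h p ≤ (m + 1 : ℕ) * h.priceCap a := by
      filter_upwards [S.noRaise k h] with p hp
      have h_cont (b : Bool) : total S B pay v m (h.extend p b) ≤ m * h.priceCap a :=
        (ih _).trans (by gcongr; exact h.priceCap_extend_le p b a)
      push_cast
      rw [add_one_mul, add_comm (_ * _)]
      rcases le_or_gt (t k h p : ℝ) v with htv | htv
      · have hpa : p ≤ a := (ht k h p).trans (NNReal.coe_le_coe.1 (htv.trans hv))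
        have hp_cap : p ≤ h.priceCap a := (h.le_priceCap_iff a).2 ⟨hpa, hp⟩
        rw [hB.respond_of_le htv]
        exact add_le_add (ENNReal.coe_le_coe.2 hp_cap) (h_cont true)
      · rw [hB.respond_of_lt htv]
        exact (h_cont false).trans le_add_self
    exact (lintegral_mono_ae h_respond).trans (by simp)

lemma total_pay_ne_top (hB : IsThreshold B t) (ht : ∀ k h p, p ≤ t k h p) (S : SellerStrategy)
    (v : ℝ) (m : ℕ) (h : Hist k) : total S B pay v m h ≠ ⊤ :=
  ne_top_of_le_ne_top (by finiteness) (hB.total_pay_le ht S v.le_coe_toNNReal m h)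

end IsThreshold

/-! ### Optimal replies of the buyer to posted prices -/

/-- The utility of the buyer of value `v` who reacts optimally to the price `p` after `h`, if `V`
is his utility from the next round on. -/
noncomputable def reactionValue (V : ∀ k, Hist k → ℝ) (v : ℝ) {k : ℕ} (h : Hist k) (p : ℝ≥0) : ℝ :=
  max (v - p + V (k + 1) (h.extend p true)) (V (k + 1) (h.extend p false))

/-- The Bellman equation: `V` is the utility of an optimal buyer of value `v` in the `n`-round game
in which the seller posts the price `f k h` after `h`. -/
structure IsBuyerValue (n : ℕ) (f : ∀ k, Hist k → ℝ≥0) (v : ℝ) (V : ∀ k, Hist k → ℝ) : Prop where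
  nonneg : ∀ k h, 0 ≤ V k h
  final : ∀ h, V n h = 0
  bellman : ∀ k < n, ∀ h, V k h = reactionValue V v h (f k h)

/-- Measured by the utilities `V` from the next round on, the buyer of value `v` with thresholds
`t` reacts optimally to every price. -/
def IsOptimalThreshold (t : ∀ k, Hist k → ℝ≥0 → ℝ≥0) (v : ℝ) (V : ∀ k, Hist k → ℝ) : Prop :=
  ∀ k (h : Hist k) p, reactionValue V v h p =
    if t k h p ≤ v then v - p + V (k + 1) (h.extend p true) else V (k + 1) (h.extend p false)

lemma coe_sub_coe_le_of_le_add {x y z : ℝ≥0∞} (h : x ≤ y + z) : (x : EReal) - y ≤ z :=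
  EReal.sub_le_of_le_add' (by exact_mod_cast h)

lemma coe_add_sub_coe {x y : ℝ≥0∞} (hx : x ≠ ⊤) : ((x + y : ℝ≥0∞) : EReal) - x = y := by
  lift x to ℝ≥0 using hx
  rw [EReal.coe_ennreal_add]
  exact EReal.add_sub_cancel_left

namespace IsBuyerValue

variable {n : ℕ} {f : ∀ k, Hist k → ℝ≥0} {v : ℝ} {V : ∀ k, Hist k → ℝ} {S : SellerStrategy}
  {B : BuyerStrategy} {t : ∀ k, Hist k → ℝ≥0 → ℝ≥0} {k m : ℕ}

lemma reactionValue_nonneg (hV : IsBuyerValue n f v V) (h : Hist k) (p : ℝ≥0) :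
    0 ≤ reactionValue V v h p := (hV.nonneg _ _).trans (le_max_right _ _)

lemma respond_le (hV : IsBuyerValue n f v V) (hv : 0 ≤ v) (B : BuyerStrategy)
    {G P : Hist (k + 1) → ℝ≥0∞} (hG : ∀ h, G h ≤ P h + ENNReal.ofReal (V (k + 1) h))
    (h : Hist k) (p : ℝ≥0) :
    respond B (fun _ => ENNReal.ofReal v) v G h p ≤
      respond B pay v P h p + ENNReal.ofReal (reactionValue V v h p) := by
  set M := ENNReal.ofReal (reactionValue V v h p)
  have h_accept : ENNReal.ofReal v + ENNReal.ofReal (V _ (h.extend p true)) ≤ p + M := by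
    rw [← ENNReal.ofReal_coe_nnreal, ← ENNReal.ofReal_add hv (hV.nonneg _ _),
      ← ENNReal.ofReal_add p.coe_nonneg (hV.reactionValue_nonneg h p)]
    refine ENNReal.ofReal_le_ofReal ?_
    have : v - p + V (k + 1) (h.extend p true) ≤ reactionValue V v h p := le_max_left _ _
    linarith
  have h_reject : ENNReal.ofReal (V _ (h.extend p false)) ≤ M :=
    ENNReal.ofReal_le_ofReal (le_max_right _ _)
  set α := B.prob true v h p
  set β := B.prob false v h p
  calc respond B (fun _ => ENNReal.ofReal v) v G h p
      = α * (ENNReal.ofReal v + G (h.extend p true)) + β * G (h.extend p false) := rfl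
    _ ≤ α * (ENNReal.ofReal v + (P (h.extend p true) + ENNReal.ofReal (V _ (h.extend p true)))) +
          β * (P (h.extend p false) + ENNReal.ofReal (V _ (h.extend p false))) := by
        gcongr <;> exact hG _
    _ = α * (P (h.extend p true) + (ENNReal.ofReal v + ENNReal.ofReal (V _ (h.extend p true)))) +
          β * (P (h.extend p false) + ENNReal.ofReal (V _ (h.extend p false))) := by ring
    _ ≤ α * (P (h.extend p true) + (p + M)) + β * (P (h.extend p false) + M) := by gcongr
    _ = α * (p + P (h.extend p true)) + β * P (h.extend p false) + (α + β) * M := by ring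
    _ = respond B pay v P h p + M := by rw [prob_true_add_prob_false, one_mul]; rfl

lemma respond_eq (hV : IsBuyerValue n f v V) (hv : 0 ≤ v) (hB : IsThreshold B t)
    (ht : IsOptimalThreshold t v V) {G P : Hist (k + 1) → ℝ≥0∞}
    (hG : ∀ h, G h = P h + ENNReal.ofReal (V (k + 1) h)) (h : Hist k) (p : ℝ≥0) :
    respond B (fun _ => ENNReal.ofReal v) v G h p =
      respond B pay v P h p + ENNReal.ofReal (reactionValue V v h p) := by
  rcases le_or_gt (t k h p : ℝ) v with htv | htv
  · have h_accept : ENNReal.ofReal v + ENNReal.ofReal (V _ (h.extend p true)) =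
        p + ENNReal.ofReal (reactionValue V v h p) := by
      rw [← ENNReal.ofReal_coe_nnreal, ← ENNReal.ofReal_add hv (hV.nonneg _ _),
        ← ENNReal.ofReal_add p.coe_nonneg (hV.reactionValue_nonneg h p), ht, if_pos htv]
      congr 1
      ring
    rw [hB.respond_of_le htv, hB.respond_of_le htv, hG, add_left_comm, h_accept, pay]
    ring
  · rw [hB.respond_of_lt htv, hB.respond_of_lt htv, hG, ht, if_neg htv.not_ge]

lemma total_le (hV : IsBuyerValue n f v V) (hv : 0 ≤ v)
    (hS : ∀ k h, S.price k h = Measure.dirac (f k h)) (B : BuyerStrategy) (hk : k + m = n)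
    (h : Hist k) :
    total S B (fun _ => ENNReal.ofReal v) v m h ≤
      total S B pay v m h + ENNReal.ofReal (V k h) := by
  induction m generalizing k with
  | zero => simp [total]
  | succ m ih =>
    rw [total_succ_of_price_eq_dirac (hS k h), total_succ_of_price_eq_dirac (hS k h),
      hV.bellman k (by omega)]
    exact hV.respond_le hv B (fun h' => ih (by omega) h') h _

lemma total_eq (hV : IsBuyerValue n f v V) (hv : 0 ≤ v)
    (hS : ∀ k h, S.price k h = Measure.dirac (f k h)) (hB : IsThreshold B t)
    (ht : IsOptimalThreshold t v V) (hk : k + m = n) (h : Hist k) :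
    total S B (fun _ => ENNReal.ofReal v) v m h =
      total S B pay v m h + ENNReal.ofReal (V k h) := by
  induction m generalizing k with
  | zero =>
    obtain rfl : k = n := by omega
    simp [total, hV.final]
  | succ m ih =>
    rw [total_succ_of_price_eq_dirac (hS k h), total_succ_of_price_eq_dirac (hS k h),
      hV.bellman k (by omega)]
    exact hV.respond_eq hv hB ht (fun h' => ih (by omega) h') h _

theorem buyerUtility_le (hV : IsBuyerValue n f v V) (hv : 0 ≤ v)
    (hS : ∀ k h, S.price k h = Measure.dirac (f k h)) (hB : IsThreshold B t)
    (hpt : ∀ k h p, p ≤ t k h p) (ht : IsOptimalThreshold t v V) (hk : k + m = n) (h : Hist k)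
    (B' : BuyerStrategy) : buyerUtility S B' v m h ≤ buyerUtility S B v m h := by
  unfold buyerUtility
  rw [hV.total_eq hv hS hB ht hk, coe_add_sub_coe (hB.total_pay_ne_top hpt S v m h)]
  exact coe_sub_coe_le_of_le_add (hV.total_le hv hS B' hk h)

theorem buyerUtilityMid_le (hV : IsBuyerValue n f v V) (hv : 0 ≤ v)
    (hS : ∀ k h, S.price k h = Measure.dirac (f k h)) (hB : IsThreshold B t)
    (hpt : ∀ k h p, p ≤ t k h p) (ht : IsOptimalThreshold t v V) (hk : k + 1 + m = n) (h : Hist k)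
    (p : ℝ≥0) (B' : BuyerStrategy) :
    buyerUtilityMid S B' v m h p ≤ buyerUtilityMid S B v m h p := by
  have h_pay : respond B pay v (total S B pay v m) h p ≠ ⊤ := by
    have h_total := hB.total_pay_ne_top hpt S v m (k := k + 1)
    rcases le_or_gt (t k h p : ℝ) v with htv | htv
    · rw [hB.respond_of_le htv]
      exact ENNReal.add_ne_top.2 ⟨ENNReal.coe_ne_top, h_total _⟩
    · rw [hB.respond_of_lt htv]
      exact h_total _
  unfold buyerUtilityMid
  rw [hV.respond_eq hv hB ht (hV.total_eq hv hS hB ht hk), coe_add_sub_coe h_pay]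
  exact coe_sub_coe_le_of_le_add (hV.respond_le hv B' (hV.total_le hv hS B' hk) h p)

end IsBuyerValue

/-! ### The revenue recursion -/

/-- The revenue of the equilibrium with `n` rounds. -/
noncomputable def revenue : ℕ → ℝ≥0
  | 0 => 0
  | n + 1 => (1 + 2 * revenue n) ^ 2 / (4 * (1 + revenue n))

/-- The first-round threshold of the equilibrium with `m + 1` rounds, as a fraction of the highest
value that the seller deems possible. -/
noncomputable def cutoff (m : ℕ) : ℝ≥0 := (1 + 2 * revenue m) / (2 * (1 + revenue m))

lemma coe_revenue_succ (m : ℕ) :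
    (revenue (m + 1) : ℝ) = (1 + 2 * revenue m) ^ 2 / (4 * (1 + revenue m)) := by
  simp [revenue]

lemma coe_cutoff (m : ℕ) : (cutoff m : ℝ) = (1 + 2 * revenue m) / (2 * (1 + revenue m)) := by
  simp [cutoff]

lemma revenue_succ_pos (m : ℕ) : 0 < revenue (m + 1) := by
  rw [revenue]
  positivity

lemma cutoff_pos (m : ℕ) : 0 < cutoff m := by
  unfold cutoff
  positivity

lemma one_sub_cutoff (m : ℕ) : 1 - (cutoff m : ℝ) = 1 / (2 * (1 + revenue m)) := by
  rw [coe_cutoff]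
  field_simp
  ring

lemma cutoff_le_one (m : ℕ) : cutoff m ≤ 1 := by
  have h_gap : 0 ≤ 1 - (cutoff m : ℝ) := by
    rw [one_sub_cutoff]
    positivity
  exact_mod_cast sub_nonneg.1 h_gap

lemma cutoff_mul_le (m : ℕ) (b : ℝ≥0) : cutoff m * b ≤ b :=
  mul_le_of_le_one_left' (cutoff_le_one m)

lemma two_mul_revenue_succ (m : ℕ) :
    2 * revenue (m + 1) = cutoff m * (1 + 2 * revenue m) := by
  rw [revenue, cutoff]
  field_simp
  ring

lemma one_add_revenue_succ (m : ℕ) :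
    1 + (revenue (m + 1) : ℝ) = 1 + revenue m + 1 / (4 * (1 + revenue m)) := by
  rw [coe_revenue_succ]
  field_simp
  ring

lemma revenue_le_revenue_succ (m : ℕ) : revenue m ≤ revenue (m + 1) := by
  have h_step := one_add_revenue_succ m
  have h_pos : 0 ≤ 1 / (4 * (1 + (revenue m : ℝ))) := by positivity
  exact NNReal.coe_le_coe.1 (by linarith)

lemma two_mul_revenue_le (m : ℕ) : 2 * revenue m ≤ m := by
  induction m with
  | zero => simp [revenue]
  | succ m ih =>
    calc 2 * revenue (m + 1) = cutoff m * (1 + 2 * revenue m) := two_mul_revenue_succ m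
      _ ≤ 1 * (1 + m) := by gcongr; exact cutoff_le_one m
      _ = (m + 1 : ℕ) := by push_cast; ring

/-- The left side is the revenue from `m + 1` rounds against a value uniform on `[0, b]` (times
`b`), as a function of the first threshold `t`: it is maximal at `t = cutoff m * b`. -/
lemma first_threshold_revenue_eq (m : ℕ) (b t : ℝ) :
    t * (1 + 2 * revenue m) * (b - t) + t ^ 2 * revenue m =
      b ^ 2 * revenue (m + 1) - (1 + revenue m) * (t - cutoff m * b) ^ 2 := by
  rw [coe_revenue_succ, coe_cutoff]
  field_simp
  ring

/-! ### Thresholds before the first sale -/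

/-- The type that is indifferent between accepting and rejecting the price `p`, if the seller
believes that the value is uniform on `[0, b]`, nothing has been sold, and `m` rounds follow: its
gain `(m + 1) * (t - p)` from accepting equals `m * t - 2 * revenue m * min b t`. The first
argument of `max` is the larger one iff `t ≤ b`. -/
noncomputable def indifferentType (m : ℕ) (b p : ℝ≥0) : ℝ≥0 :=
  max ((m + 1) * p / (1 + 2 * revenue m)) ((m + 1) * p - 2 * revenue m * b)

lemma coe_indifferentType (m : ℕ) (b p : ℝ≥0) :
    (indifferentType m b p : ℝ) =
      max ((m + 1) * (p : ℝ) / (1 + 2 * revenue m)) ((m + 1) * p - 2 * revenue m * b : ℝ) := by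
  have h_nonneg : (0 : ℝ) ≤ (m + 1) * p / (1 + 2 * revenue m) := by positivity
  simp only [indifferentType, NNReal.coe_max, NNReal.coe_sub_def]
  push_cast
  rw [max_comm _ (0 : ℝ), max_left_comm, max_eq_right (h_nonneg.trans (le_max_left _ _))]

lemma indifferentType_cases (m : ℕ) (b p : ℝ≥0) :
    (indifferentType m b p ≤ b ∧ indifferentType m b p * (1 + 2 * revenue m) = (m + 1) * p) ∨
      (b ≤ indifferentType m b p ∧ indifferentType m b p + 2 * revenue m * b = (m + 1) * p) := by
  simp only [← NNReal.coe_le_coe, ← NNReal.coe_inj]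
  push_cast
  rw [coe_indifferentType]
  have h_pos : (0 : ℝ) < 1 + 2 * revenue m := by positivity
  have h_r : (0 : ℝ) ≤ revenue m := by positivity
  rcases le_total ((m + 1) * (p : ℝ)) ((1 + 2 * revenue m) * b) with h | h
  · left
    rw [max_eq_left, div_le_iff₀ h_pos, div_mul_cancel₀ _ h_pos.ne']
    · exact ⟨by linarith, rfl⟩
    · rw [le_div_iff₀ h_pos]
      nlinarith [mul_le_mul_of_nonneg_left h h_r]
  · right
    rw [max_eq_right]
    · exact ⟨by linarith, by ring⟩
    · rw [div_le_iff₀ h_pos]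
      nlinarith [mul_le_mul_of_nonneg_left h h_r]

lemma indifferentType_add (m : ℕ) (b p : ℝ≥0) :
    indifferentType m b p + 2 * revenue m * min b (indifferentType m b p) = (m + 1) * p := by
  rcases indifferentType_cases m b p with ⟨h_le, h⟩ | ⟨h_le, h⟩
  · rw [min_eq_right h_le, ← h]
    ring
  · rw [min_eq_left h_le, h]

lemma le_indifferentType (m : ℕ) (b p : ℝ≥0) : p ≤ indifferentType m b p := by
  set t := indifferentType m b p
  refine le_of_mul_le_mul_left ?_ (by positivity : (0 : ℝ≥0) < m + 1)
  calc (m + 1) * p = t + 2 * revenue m * min b t := (indifferentType_add m b p).symm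
    _ ≤ t + m * t := by gcongr; exacts [two_mul_revenue_le m, min_le_right _ _]
    _ = (m + 1) * t := by ring

@[simp] lemma indifferentType_zero (m : ℕ) (b : ℝ≥0) : indifferentType m b 0 = 0 := by
  simp [indifferentType]

/-- The upper end of the support of the seller's belief after a rejection of `p`. No type rejects
the price `0`, so that the belief is then free; it is left unchanged. -/
noncomputable def nextTop (m : ℕ) (b p : ℝ≥0) : ℝ≥0 :=
  if p = 0 then b else min b (indifferentType m b p)

lemma nextTop_of_ne_zero (m : ℕ) (b : ℝ≥0) {p : ℝ≥0} (hp : p ≠ 0) :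
    nextTop m b p = min b (indifferentType m b p) := if_neg hp

lemma nextTop_le (m : ℕ) (b p : ℝ≥0) : nextTop m b p ≤ b := by
  unfold nextTop
  split_ifs <;> simp

lemma nextTop_pos (m : ℕ) {b : ℝ≥0} (hb : 0 < b) (p : ℝ≥0) : 0 < nextTop m b p := by
  unfold nextTop
  split_ifs with hp
  · exact hb
  · exact lt_min hb ((pos_iff_ne_zero.2 hp).trans_le (le_indifferentType m b p))

/-- The price that the seller posts if he believes that the value is uniform on `[0, b]`, nothing
has been sold, and `m` rounds remain. -/
noncomputable def equilibriumPrice (m : ℕ) (b : ℝ≥0) : ℝ≥0 := 2 * revenue m / m * b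

lemma mul_equilibriumPrice (m : ℕ) (b : ℝ≥0) :
    (m + 1) * equilibriumPrice (m + 1) b = 2 * revenue (m + 1) * b := by
  simp only [equilibriumPrice]
  push_cast
  field_simp

lemma equilibriumPrice_ne_zero (m : ℕ) {b : ℝ≥0} (hb : 0 < b) :
    equilibriumPrice (m + 1) b ≠ 0 := by
  have h_revenue := revenue_succ_pos m
  unfold equilibriumPrice
  positivity

lemma indifferentType_equilibriumPrice (m : ℕ) (b : ℝ≥0) :
    indifferentType m b (equilibriumPrice (m + 1) b) = cutoff m * b := by
  have h_price := mul_equilibriumPrice m b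
  rw [two_mul_revenue_succ] at h_price
  have h_le := cutoff_mul_le m b
  rcases indifferentType_cases m b (equilibriumPrice (m + 1) b) with ⟨-, h⟩ | ⟨h_ge, h⟩
  · rw [h_price] at h
    refine mul_right_cancel₀ (by positivity : 1 + 2 * revenue m ≠ 0) (h.trans ?_)
    ring
  · rw [h_price] at h
    refine le_antisymm ?_ (h_le.trans h_ge)
    refine le_of_add_le_add_right (a := 2 * revenue m * (cutoff m * b)) ?_
    calc _ ≤ indifferentType m b (equilibriumPrice (m + 1) b) + 2 * revenue m * b := by gcongr
      _ = cutoff m * b + 2 * revenue m * (cutoff m * b) := by rw [h]; ring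

lemma nextTop_equilibriumPrice (m : ℕ) {b : ℝ≥0} (hb : 0 < b) :
    nextTop m b (equilibriumPrice (m + 1) b) = cutoff m * b := by
  rw [nextTop_of_ne_zero m b (equilibriumPrice_ne_zero m hb), indifferentType_equilibriumPrice,
    min_eq_right (cutoff_mul_le m b)]

/-- The revenue, times `b`, from posting `p` and playing the equilibrium in the `m` rounds that
follow, if the value is uniform on `[0, b]` and nothing has been sold. The difference is
truncated: no type accepts if the threshold exceeds `b`. -/
noncomputable def stageRevenue (m : ℕ) (b p : ℝ≥0) : ℝ≥0 :=
  (m + 1) * p * (b - indifferentType m b p) + min b (indifferentType m b p) ^ 2 * revenue m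

lemma stageRevenue_le (m : ℕ) (b p : ℝ≥0) : stageRevenue m b p ≤ b ^ 2 * revenue (m + 1) := by
  unfold stageRevenue
  rcases indifferentType_cases m b p with ⟨h_le, h⟩ | ⟨h_le, -⟩
  · rw [min_eq_right h_le, ← h, ← NNReal.coe_le_coe]
    push_cast [NNReal.coe_sub h_le]
    rw [first_threshold_revenue_eq]
    exact sub_le_self _ (by positivity)
  · rw [tsub_eq_zero_of_le h_le, mul_zero, zero_add, min_eq_left h_le]
    gcongr
    exact revenue_le_revenue_succ m

lemma stageRevenue_equilibriumPrice (m : ℕ) (b : ℝ≥0) :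
    stageRevenue m b (equilibriumPrice (m + 1) b) = b ^ 2 * revenue (m + 1) := by
  have h_le := cutoff_mul_le m b
  rw [stageRevenue, mul_equilibriumPrice, two_mul_revenue_succ, indifferentType_equilibriumPrice,
    min_eq_right h_le, ← NNReal.coe_inj]
  push_cast [NNReal.coe_sub h_le]
  have h := first_threshold_revenue_eq m b (cutoff m * b)
  rw [sub_self] at h
  linear_combination h

/-! ### The surplus of the buyer before the first sale -/

/-- The utility of the buyer of value `v` in the equilibrium with `m` rounds, if the seller believes
that the value is uniform on `[0, b]`. -/
noncomputable def surplus : ℕ → ℝ → ℝ → ℝ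
  | 0, _, _ => 0
  | m + 1, b, v =>
    if cutoff m * b ≤ v then (m + 1) * v - 2 * revenue (m + 1) * b else surplus m (cutoff m * b) v

lemma surplus_of_le {b v : ℝ} (hb : 0 ≤ b) (hv : b ≤ v) (m : ℕ) :
    surplus m b v = m * v - 2 * revenue m * b := by
  cases m with
  | zero => simp [surplus, revenue]
  | succ m =>
    have h_cutoff : cutoff m * b ≤ b :=
      mul_le_of_le_one_left hb (NNReal.coe_le_one.2 (cutoff_le_one m))
    rw [surplus, if_pos (h_cutoff.trans hv)]
    push_cast
    rfl

lemma coe_two_mul_revenue_succ_mul (m : ℕ) (b : ℝ) :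
    2 * revenue (m + 1) * b = (1 + 2 * revenue m) * (cutoff m * b) := by
  have h := congrArg NNReal.toReal (two_mul_revenue_succ m)
  push_cast at h
  rw [h]
  ring

lemma surplus_sub_le (m : ℕ) {b v v' : ℝ} (hb : 0 ≤ b) (hv : v ≤ v') :
    surplus m b v' - surplus m b v ≤ m * (v' - v) := by
  induction m generalizing b v v' with
  | zero => simp [surplus]
  | succ m ih =>
    have hc : 0 ≤ cutoff m * b := by positivity
    simp only [surplus]
    push_cast
    split_ifs with h' h h
    · linarith
    · have h_step := ih hc (not_le.1 h).le
      rw [surplus_of_le hc le_rfl] at h_step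
      rw [coe_two_mul_revenue_succ_mul]
      linarith
    · exact (h' (h.trans hv)).elim
    · linarith [ih hc hv]

lemma surplus_nonneg (m : ℕ) {b : ℝ} (hb : 0 ≤ b) (v : ℝ) : 0 ≤ surplus m b v := by
  induction m generalizing b with
  | zero => simp [surplus]
  | succ m ih =>
    have hc : 0 ≤ cutoff m * b := by positivity
    rw [surplus]
    split_ifs with hv
    · have h_le : 2 * (revenue m : ℝ) ≤ m := by exact_mod_cast two_mul_revenue_le m
      rw [coe_two_mul_revenue_succ_mul, sub_nonneg]
      calc (1 + 2 * revenue m) * (cutoff m * b) ≤ (1 + m) * (cutoff m * b) := by gcongr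
        _ ≤ (1 + m) * v := by gcongr
        _ = (m + 1) * v := by ring
    · exact ih hc

lemma surplus_zero (m : ℕ) {b : ℝ} (hb : 0 < b) : surplus m b 0 = 0 := by
  induction m generalizing b with
  | zero => rfl
  | succ m ih =>
    have hc : 0 < cutoff m * b := mul_pos (cutoff_pos m) hb
    rw [surplus, if_neg hc.not_ge, ih hc]

lemma surplus_nextTop (m : ℕ) (b : ℝ≥0) {p : ℝ≥0} (hp : p ≠ 0) :
    surplus m (nextTop m b p) (indifferentType m b p) = (m + 1) * (indifferentType m b p - p) := by
  have h := congrArg NNReal.toReal (indifferentType_add m b p)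
  rw [nextTop_of_ne_zero m b hp, surplus_of_le (by positivity) (by simp)]
  push_cast at h ⊢
  linarith

/-- The utility of the buyer of value `v` from accepting `p`, with `m` rounds to follow: after this
first sale the price stays at `min 1 p`. -/
noncomputable def acceptSurplus (m : ℕ) (p : ℝ≥0) (v : ℝ) : ℝ :=
  v - p + m * max (v - min 1 (p : ℝ)) 0

lemma acceptSurplus_of_le (m : ℕ) {p : ℝ≥0} {v : ℝ} (hpv : p ≤ v) (hv : v ≤ 1) :
    acceptSurplus m p v = (m + 1) * (v - p) := by
  rw [acceptSurplus, min_eq_right (hpv.trans hv), max_eq_left (sub_nonneg.2 hpv)]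
  ring

lemma acceptSurplus_le_surplus (m : ℕ) (b : ℝ≥0) {p : ℝ≥0} {v : ℝ} (hv : v ∈ Set.Icc 0 1)
    (hvt : v < indifferentType m b p) : acceptSurplus m p v ≤ surplus m (nextTop m b p) v := by
  rcases le_or_gt (p : ℝ) v with hpv | hpv
  · have hp : p ≠ 0 := by
      rintro rfl
      simp [hv.1.not_gt] at hvt
    have h_slope := surplus_sub_le m (nextTop m b p).coe_nonneg hvt.le
    rw [surplus_nextTop m b hp] at h_slope
    rw [acceptSurplus_of_le m hpv hv.2]
    linarith
  · have h_late : v - min 1 (p : ℝ) ≤ 0 := sub_nonpos.2 (le_min hv.2 hpv.le)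
    have h_nonneg := surplus_nonneg m (nextTop m b p).coe_nonneg v
    rw [acceptSurplus, max_eq_right h_late]
    linarith

lemma surplus_le_acceptSurplus (m : ℕ) {b p : ℝ≥0} {v : ℝ} (hb : 0 < b) (hv : v ≤ 1)
    (htv : indifferentType m b p ≤ v) : surplus m (nextTop m b p) v ≤ acceptSurplus m p v := by
  have hpv : (p : ℝ) ≤ v := (NNReal.coe_le_coe.2 (le_indifferentType m b p)).trans htv
  have h_slope := surplus_sub_le m (nextTop m b p).coe_nonneg htv
  rw [acceptSurplus_of_le m hpv hv]
  rcases eq_or_ne p 0 with rfl | hp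
  · rw [indifferentType_zero, NNReal.coe_zero,
      surplus_zero m (NNReal.coe_pos.2 (nextTop_pos m hb 0))] at h_slope
    push_cast at hpv ⊢
    linarith
  · rw [surplus_nextTop m b hp] at h_slope
    linarith

lemma surplus_succ_eq (m : ℕ) (b : ℝ≥0) {v : ℝ} (hv : v ≤ 1) :
    surplus (m + 1) b v =
      if (cutoff m * b : ℝ≥0) ≤ v then acceptSurplus m (equilibriumPrice (m + 1) b) v
      else surplus m (cutoff m * b : ℝ≥0) v := by
  rw [surplus, NNReal.coe_mul]
  refine if_ctx_congr Iff.rfl (fun h_le => ?_) fun _ => rfl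
  have h_price : ((m : ℝ) + 1) * equilibriumPrice (m + 1) b = 2 * revenue (m + 1) * b := by
    exact_mod_cast mul_equilibriumPrice m b
  have h_price_le : (equilibriumPrice (m + 1) b : ℝ) ≤ v := by
    refine le_trans (NNReal.coe_le_coe.2 (le_indifferentType m b _)) ?_
    rwa [indifferentType_equilibriumPrice, NNReal.coe_mul]
  rw [acceptSurplus_of_le m h_price_le hv]
  linarith

/-! ### The equilibrium strategies -/

/-- The highest value that the seller deems possible after a history without sales, in the game
with `n` rounds. -/
noncomputable def beliefTop (n : ℕ) : {k : ℕ} → Hist k → ℝ≥0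
  | 0, _ => 1
  | k + 1, h => nextTop (n - (k + 1)) (beliefTop n (Fin.init h : Hist k)) (h (Fin.last k)).1

/-- The price that the seller posts: the highest one allowed, but at most `1`, after a sale. -/
noncomputable def offer (n k : ℕ) (h : Hist k) : ℝ≥0 :=
  if h.Sold then h.priceCap 1 else equilibriumPrice (n - k) (beliefTop n h)

/-- The threshold of the buyer. -/
noncomputable def threshold (n k : ℕ) (h : Hist k) (p : ℝ≥0) : ℝ≥0 :=
  if h.Sold then p else indifferentType (n - (k + 1)) (beliefTop n h) p

section Strategies

variable (n : ℕ) {k : ℕ} (h : Hist k) (p : ℝ≥0) (b : Bool)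

@[simp] lemma beliefTop_root : beliefTop n Hist.root = 1 := rfl

@[simp] lemma beliefTop_extend :
    beliefTop n (h.extend p b) = nextTop (n - (k + 1)) (beliefTop n h) p := by
  rw [beliefTop, Hist.init_extend, Hist.extend_last]

lemma beliefTop_pos : 0 < beliefTop n h := by
  induction h using Hist.induction with
  | root => exact one_pos
  | extend k h p b ih => simpa using nextTop_pos _ ih p

lemma beliefTop_le_one : beliefTop n h ≤ 1 := by
  induction h using Hist.induction with
  | root => exact le_rfl
  | extend k h p b ih => simpa using (nextTop_le _ _ p).trans ih

lemma allowed_offer : Allowed h (offer n k h) := by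
  unfold offer
  split_ifs with hs
  · exact allowed_priceCap h 1
  · exact allowed_of_not_sold hs _

lemma le_threshold : p ≤ threshold n k h p := by
  unfold threshold
  split_ifs
  · exact le_rfl
  · exact le_indifferentType _ _ _

lemma measurableSet_allowed (q : ℝ≥0) : MeasurableSet {h : Hist k | Allowed h q} := by
  simp only [Allowed]
  measurability

lemma measurableSet_sold : MeasurableSet {h : Hist k | h.Sold} := by
  simp only [Hist.Sold]
  measurability

@[fun_prop] lemma measurable_priceCap (a : ℝ≥0) :
    Measurable fun h : Hist k => h.priceCap a := by
  refine measurable_of_Ici fun q => ?_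
  simp only [Set.preimage, Set.mem_Ici, Hist.le_priceCap_iff]
  exact (MeasurableSet.const _).inter (measurableSet_allowed q)

@[fun_prop] lemma measurable_indifferentType (m : ℕ) {α : Type*} [MeasurableSpace α]
    {f g : α → ℝ≥0} (hf : Measurable f) (hg : Measurable g) :
    Measurable fun x => indifferentType m (f x) (g x) := by
  unfold indifferentType
  fun_prop

@[fun_prop] lemma measurable_beliefTop : Measurable (beliefTop n : Hist k → ℝ≥0) := by
  induction k with
  | zero => exact measurable_const
  | succ k ih =>
    have h_init : Measurable fun h : Hist (k + 1) => beliefTop n (Fin.init h : Hist k) :=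
      ih.comp (measurable_pi_lambda _ fun i => measurable_pi_apply i.castSucc)
    have h_last : Measurable fun h : Hist (k + 1) => (h (Fin.last k)).1 := by fun_prop
    exact Measurable.ite (h_last (measurableSet_singleton 0)) h_init (by fun_prop)

lemma measurable_offer : Measurable (offer n k) :=
  Measurable.ite measurableSet_sold (measurable_priceCap 1) ((measurable_beliefTop n).const_mul _)

lemma measurable_threshold : Measurable fun x : Hist k × ℝ≥0 => threshold n k x.1 x.2 :=
  Measurable.ite (measurable_fst measurableSet_sold) measurable_snd (by fun_prop)

end Strategies

/-- The equilibrium strategy of the seller in the game with `n` rounds. -/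
noncomputable def seller (n : ℕ) : SellerStrategy where
  price k := Kernel.deterministic (offer n k) (measurable_offer n)
  markov _ := inferInstance
  noRaise k h := by
    rw [Kernel.deterministic_apply, ae_dirac_eq]
    exact allowed_offer n h

/-- The equilibrium strategy of the buyer in the game with `n` rounds. -/
noncomputable def buyer (n : ℕ) : BuyerStrategy where
  accept k v h p := if (threshold n k h p : ℝ) ≤ v then 1 else 0
  accept_le_one k v h p := by split_ifs <;> simp
  measurable_accept k :=
    have h_threshold := (measurable_threshold n (k := k)).comp measurable_snd
    Measurable.ite (measurableSet_le h_threshold.coe_nnreal_real measurable_fst) measurable_const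
      measurable_const

lemma price_seller (n k : ℕ) (h : Hist k) :
    (seller n).price k h = Measure.dirac (offer n k h) :=
  Kernel.deterministic_apply (measurable_offer n) h

lemma isThreshold_buyer (n : ℕ) : IsThreshold (buyer n) (threshold n) := fun _ _ _ _ => rfl

/-! ### Optimality for the buyer -/

/-- The utility of the buyer of value `v` after `h` in the equilibrium with `n` rounds. -/
noncomputable def value (n : ℕ) (v : ℝ) (k : ℕ) (h : Hist k) : ℝ :=
  if h.Sold then (n - k : ℕ) * max (v - h.priceCap 1) 0 else surplus (n - k) (beliefTop n h) v

section BuyerOptimality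

variable {n k : ℕ} {v : ℝ}

lemma value_extend_true {h : Hist k} (hs : ¬ h.Sold) (p : ℝ≥0) :
    v - p + value n v (k + 1) (h.extend p true) = acceptSurplus (n - (k + 1)) p v := by
  simp [value, acceptSurplus, Hist.priceCap_of_not_sold 1 hs]

lemma value_extend_false {h : Hist k} (hs : ¬ h.Sold) (p : ℝ≥0) :
    value n v (k + 1) (h.extend p false) =
      surplus (n - (k + 1)) (nextTop (n - (k + 1)) (beliefTop n h) p) v := by
  simp [value, hs]

lemma isOptimalThreshold_threshold (n : ℕ) (hv : v ∈ Set.Icc 0 1) :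
    IsOptimalThreshold (threshold n) v (value n v) := by
  intro k h p
  by_cases hs : h.Sold
  · set m := n - (k + 1) with hm
    simp only [reactionValue, threshold, value, Hist.sold_extend, hs, true_or, if_true, ← hm,
      Hist.priceCap_extend_true, Hist.priceCap_extend_false]
    split_ifs with hpv
    · refine max_eq_left ?_
      have h_cap : min (h.priceCap 1) p ≤ h.priceCap 1 := min_le_left _ _
      calc (m : ℝ) * max (v - h.priceCap 1) 0
          ≤ m * max (v - (min (h.priceCap 1) p : ℝ≥0)) 0 := by gcongr
        _ ≤ _ := le_add_of_nonneg_left (sub_nonneg.2 hpv)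
    · have h_late : max (v - (min (h.priceCap 1) p : ℝ≥0)) 0 ≤ max (v - h.priceCap 1) 0 := by
        rcases min_choice (h.priceCap 1) p with h_min | h_min
        · rw [h_min]
        · rw [h_min, max_eq_right (by linarith)]
          exact le_max_right _ _
      have h_late' := mul_le_mul_of_nonneg_left h_late (Nat.cast_nonneg' m)
      exact max_eq_right (by linarith)
  · rw [reactionValue, value_extend_true hs, value_extend_false hs, threshold, if_neg hs]
    split_ifs with htv
    · exact max_eq_left (surplus_le_acceptSurplus _ (beliefTop_pos n h) hv.2 htv)
    · exact max_eq_right (acceptSurplus_le_surplus _ _ hv (not_le.1 htv))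

lemma value_eq_reactionValue (hv : v ∈ Set.Icc 0 1) (hk : k < n) (h : Hist k) :
    value n v k h = reactionValue (value n v) v h (offer n k h) := by
  obtain ⟨m, rfl⟩ : ∃ m, n = k + 1 + m := Nat.exists_eq_add_of_le hk
  have h_now : k + 1 + m - k = m + 1 := by omega
  have h_next : k + 1 + m - (k + 1) = m := by omega
  rw [isOptimalThreshold_threshold _ hv]
  by_cases hs : h.Sold
  · simp only [value, threshold, offer, Hist.sold_extend, hs, true_or, if_true, h_now, h_next,
      Hist.priceCap_extend_true, Hist.priceCap_extend_false, min_self]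
    split_ifs with h_le
    · rw [max_eq_left (sub_nonneg.2 h_le)]
      push_cast
      ring
    · rw [max_eq_right (by linarith), mul_zero, mul_zero]
  · rw [value_extend_true hs, value_extend_false hs, threshold, if_neg hs, offer, if_neg hs, value,
      if_neg hs, h_now, h_next, indifferentType_equilibriumPrice,
      nextTop_equilibriumPrice m (beliefTop_pos _ h), surplus_succ_eq m _ hv.2]

lemma isBuyerValue_value (n : ℕ) (hv : v ∈ Set.Icc 0 1) :
    IsBuyerValue n (offer n) v (value n v) where
  nonneg k h := by
    unfold value
    split_ifs
    · positivity
    · exact surplus_nonneg _ (NNReal.coe_nonneg _) v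
  final h := by simp [value, surplus]
  bellman _ hk h := value_eq_reactionValue hv hk h

end BuyerOptimality

/-! ### Optimality for the seller -/

section SellerOptimality

variable {n k : ℕ}

lemma total_pay_buyer_le (S : SellerStrategy) (n : ℕ) {v : ℝ} (hv : v ≤ 1) (m : ℕ) (h : Hist k) :
    total S (buyer n) pay v m h ≤ m * h.priceCap 1 :=
  (isThreshold_buyer n).total_pay_le (fun _ h p => le_threshold n h p) S (by simpa using hv) m h

lemma total_pay_seller_eq {v : ℝ} {h : Hist k} (hs : h.Sold) (hv : h.priceCap 1 ≤ v) (m : ℕ) :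
    total (seller n) (buyer n) pay v m h = m * h.priceCap 1 := by
  induction m generalizing k with
  | zero => simp [total]
  | succ m ih =>
    have h_offer : offer n k h = h.priceCap 1 := if_pos hs
    have h_accept : (threshold n k h (h.priceCap 1) : ℝ) ≤ v := by rwa [threshold, if_pos hs]
    have h_cap : (h.extend (h.priceCap 1) true).priceCap 1 = h.priceCap 1 := by simp
    rw [total_succ_of_price_eq_dirac (price_seller n k h), h_offer,
      (isThreshold_buyer n).respond_of_le h_accept, ih (by simp) (by rwa [h_cap]), h_cap, pay]
    push_cast
    ring

lemma total_pay_le_seller (S : SellerStrategy) {v : ℝ} {h : Hist k} (hs : h.Sold)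
    (hv : v ∈ Set.Icc (h.priceCap 1 : ℝ) 1) (m : ℕ) :
    total S (buyer n) pay v m h ≤ total (seller n) (buyer n) pay v m h :=
  (total_pay_buyer_le S n hv.2 m h).trans_eq (total_pay_seller_eq hs hv.1 m).symm

lemma min_threshold_eq {h : Hist k} (hs : ¬ h.Sold) (p : ℝ≥0) :
    min (beliefTop n h) (threshold n k h p) = 0 ∨
      min (beliefTop n h) (threshold n k h p) = beliefTop n (h.extend p false) := by
  rw [threshold, if_neg hs, beliefTop_extend]
  rcases eq_or_ne p 0 with rfl | hp
  · left
    rw [indifferentType_zero, min_eq_right zero_le]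
  · exact Or.inr (nextTop_of_ne_zero _ _ hp).symm

lemma volume_Icc_coe (a b : ℝ≥0) : volume (Set.Icc (a : ℝ) b) = (b - a : ℝ≥0) := by
  rw [Real.volume_Icc, ENNReal.ofReal, NNReal.sub_def]

/-- An accepted price is paid in each of the `m + 1` rounds. -/
lemma lintegral_accept_seller {h : Hist k} (hs : ¬ h.Sold) (p : ℝ≥0) (m : ℕ) :
    ∫⁻ v in Set.Icc (threshold n k h p : ℝ) (beliefTop n h),
        (pay p + total (seller n) (buyer n) pay v m (h.extend p true)) =
      ((m + 1) * p * (beliefTop n h - threshold n k h p) : ℝ≥0) := by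
  have h_pay {v : ℝ} (hv : v ∈ Set.Icc (threshold n k h p : ℝ) (beliefTop n h)) :
      pay p + total (seller n) (buyer n) pay v m (h.extend p true) = ((m + 1) * p : ℝ≥0) := by
    have hp_cap : (h.extend p true).priceCap 1 = p := by
      rw [Hist.priceCap_extend_true, Hist.priceCap_of_not_sold 1 hs]
      refine min_eq_right ((le_threshold n h p).trans ?_)
      exact NNReal.coe_le_coe.1 (hv.1.trans (hv.2.trans (beliefTop_le_one n h)))
    have hpv : ((h.extend p true).priceCap 1 : ℝ) ≤ v := by
      rw [hp_cap]
      exact (NNReal.coe_le_coe.2 (le_threshold n h p)).trans hv.1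
    rw [total_pay_seller_eq (by simp) hpv, hp_cap, pay]
    push_cast
    ring
  rw [setLIntegral_congr_fun measurableSet_Icc fun v hv => h_pay hv, setLIntegral_const,
    volume_Icc_coe, ← ENNReal.coe_mul]

lemma lintegral_respond_seller {m : ℕ} (hn : n = k + 1 + m) {h : Hist k} (hs : ¬ h.Sold) (p : ℝ≥0)
    (h_reject : ∫⁻ v in Set.Icc (0 : ℝ) (beliefTop n (h.extend p false)),
        total (seller n) (buyer n) pay v m (h.extend p false) =
      (beliefTop n (h.extend p false) ^ 2 * revenue m : ℝ≥0)) :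
    ∫⁻ v in Set.Icc (0 : ℝ) (beliefTop n h),
        respond (buyer n) pay v (total (seller n) (buyer n) pay v m) h p =
      stageRevenue m (beliefTop n h) p := by
  have h_reject' : ∫⁻ v in Set.Icc (0 : ℝ) (min (beliefTop n h) (threshold n k h p)),
        total (seller n) (buyer n) pay v m (h.extend p false) =
      (min (beliefTop n h) (threshold n k h p) ^ 2 * revenue m : ℝ≥0) := by
    rcases min_threshold_eq hs p (n := n) with h_min | h_min <;> rw [← NNReal.coe_min, h_min]
    · simp
    · exact h_reject
  have h_threshold : threshold n k h p = indifferentType m (beliefTop n h) p := by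
    rw [threshold, if_neg hs, hn, Nat.add_sub_cancel_left]
  rw [(isThreshold_buyer n).lintegral_respond, lintegral_accept_seller hs, h_reject',
    ← ENNReal.coe_add, h_threshold, stageRevenue]

lemma lintegral_respond_le_seller (S : SellerStrategy) (m : ℕ) {h : Hist k}
    (hs : ¬ h.Sold) (p : ℝ≥0)
    (h_reject : ∫⁻ v in Set.Icc (0 : ℝ) (beliefTop n (h.extend p false)),
        total S (buyer n) pay v m (h.extend p false) ≤
      ∫⁻ v in Set.Icc (0 : ℝ) (beliefTop n (h.extend p false)),
        total (seller n) (buyer n) pay v m (h.extend p false)) :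
    ∫⁻ v in Set.Icc (0 : ℝ) (beliefTop n h),
        respond (buyer n) pay v (total S (buyer n) pay v m) h p ≤
      ∫⁻ v in Set.Icc (0 : ℝ) (beliefTop n h),
        respond (buyer n) pay v (total (seller n) (buyer n) pay v m) h p := by
  rw [(isThreshold_buyer n).lintegral_respond, (isThreshold_buyer n).lintegral_respond]
  refine add_le_add (setLIntegral_mono' measurableSet_Icc fun v hv => ?_) ?_
  · have h_cap : ((h.extend p true).priceCap 1 : ℝ) ≤ v := by
      refine (NNReal.coe_le_coe.2 ?_).trans hv.1
      rw [Hist.priceCap_extend_true]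
      exact (min_le_right _ _).trans (le_threshold n h p)
    have h_le_one : v ≤ 1 := hv.2.trans (beliefTop_le_one n h)
    gcongr
    exact total_pay_le_seller S (by simp) ⟨h_cap, h_le_one⟩ m
  · rcases min_threshold_eq hs p (n := n) with h_min | h_min <;> rw [← NNReal.coe_min, h_min]
    · simp
    · exact h_reject

theorem lintegral_total_seller {m : ℕ} (hn : n = k + m) {h : Hist k} (hs : ¬ h.Sold) :
    ∫⁻ v in Set.Icc (0 : ℝ) (beliefTop n h), total (seller n) (buyer n) pay v m h =
      (beliefTop n h ^ 2 * revenue m : ℝ≥0) := by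
  induction m generalizing k with
  | zero => simp [total, revenue]
  | succ m ih =>
    have h_offer : offer n k h = equilibriumPrice (m + 1) (beliefTop n h) := by
      rw [offer, if_neg hs, hn, Nat.add_sub_cancel_left]
    have hn' : n = k + 1 + m := by omega
    simp only [total_succ_of_price_eq_dirac (price_seller n k h)]
    rw [lintegral_respond_seller hn' hs _ (ih hn' (by simp [hs])), h_offer,
      stageRevenue_equilibriumPrice]

theorem lintegral_total_le_seller (S : SellerStrategy) {m : ℕ} (hn : n = k + m) {h : Hist k}
    (hs : ¬ h.Sold) :
    ∫⁻ v in Set.Icc (0 : ℝ) (beliefTop n h), total S (buyer n) pay v m h ≤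
      ∫⁻ v in Set.Icc (0 : ℝ) (beliefTop n h), total (seller n) (buyer n) pay v m h := by
  induction m generalizing k with
  | zero => simp [total]
  | succ m ih =>
    have hn' : n = k + 1 + m := by omega
    have := S.markov k
    have h_price (p : ℝ≥0) : ∫⁻ v in Set.Icc (0 : ℝ) (beliefTop n h),
        respond (buyer n) pay v (total S (buyer n) pay v m) h p ≤
          (beliefTop n h ^ 2 * revenue (m + 1) : ℝ≥0) := by
      have h_reject : ¬ (h.extend p false).Sold := by simp [hs]
      calc _ ≤ _ := lintegral_respond_le_seller S m hs p (ih hn' h_reject)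
        _ = stageRevenue m (beliefTop n h) p :=
          lintegral_respond_seller hn' hs p (lintegral_total_seller hn' h_reject)
        _ ≤ _ := ENNReal.coe_le_coe.2 (stageRevenue_le m _ p)
    have h_pair : Measurable fun x : ℝ × ℝ≥0 => (x.1, h, x.2) := by fun_prop
    have h_measurable : Measurable fun x : ℝ × ℝ≥0 =>
        respond (buyer n) pay x.1 (total S (buyer n) pay x.1 m) h x.2 :=
      (measurable_respond (buyer n) measurable_pay (F := fun v => total S (buyer n) pay v m)
        (measurable_total S (buyer n) measurable_pay m)).comp h_pair
    rw [lintegral_total_seller hn hs]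
    simp only [total]
    rw [lintegral_lintegral_swap h_measurable.aemeasurable]
    exact (lintegral_mono h_price).trans (by simp)

end SellerOptimality

/-! ### Beliefs and Bayes' rule -/

section Conditioning

variable {α : Type*} [MeasurableSpace α] {μ : Measure α} {s t : Set α}

lemma cond_eq_self_of_ae_mem [IsProbabilityMeasure μ] (h : ∀ᵐ x ∂μ, x ∈ s) : μ[|s] = μ := by
  have h_one : μ s = 1 := (measure_congr (eventuallyEq_univ.2 h)).trans measure_univ
  rw [ProbabilityTheory.cond, h_one, Measure.restrict_eq_self_of_ae_mem h, inv_one, one_smul]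

lemma cond_congr_set (h : s =ᵐ[μ] t) : μ[|s] = μ[|t] := by
  rw [ProbabilityTheory.cond, ProbabilityTheory.cond, measure_congr h, Measure.restrict_congr_set h]

/-- The posterior after an event whose likelihood is `0` or `1`. -/
lemma inv_lintegral_smul_withDensity_indicator (μ : Measure α) (hs : MeasurableSet s) :
    (∫⁻ x, s.indicator 1 x ∂μ)⁻¹ • μ.withDensity (s.indicator 1) = μ[|s] := by
  rw [lintegral_indicator_one hs, withDensity_indicator_one hs, ProbabilityTheory.cond]

end Conditioning

lemma isProbabilityMeasure_cond_Icc {a b : ℝ} (h : a < b) :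
    IsProbabilityMeasure (volume[|Set.Icc a b]) := by
  apply cond_isProbabilityMeasure_of_finite <;> simp [h]

lemma cond_Icc_cond {a b : ℝ} {s : Set ℝ} (hs : MeasurableSet s) :
    volume[|Set.Icc a b][|s] = volume[|Set.Icc a b ∩ s] :=
  cond_cond_eq_cond_inter' measurableSet_Icc hs (by simp)

/-- The beliefs in the equilibrium with `n` rounds. They are uniform on an interval and constant
after the first sale, except that a first sale of probability zero leads to certainty of the value
`1`: the support must not contain values below the price cap, which may be as high as `1`. -/
noncomputable def belief (n : ℕ) : BeliefSystem
  | 0, _ => volume[|Set.Icc 0 1]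
  | k + 1, h =>
    let h' : Hist k := Fin.init h
    if h'.Sold then belief n k h'
    else if (h (Fin.last k)).2 then
      if threshold n k h' (h (Fin.last k)).1 < beliefTop n h' then
        volume[|Set.Icc (threshold n k h' (h (Fin.last k)).1 : ℝ) (beliefTop n h')]
      else Measure.dirac 1
    else volume[|Set.Icc (0 : ℝ) (beliefTop n h)]

section Beliefs

variable (n : ℕ) {k : ℕ} {h : Hist k} (p : ℝ≥0) (b : Bool)

lemma belief_extend_of_sold (hs : h.Sold) : belief n (k + 1) (h.extend p b) = belief n k h := by
  simp [belief, hs]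

lemma belief_extend_true (hs : ¬ h.Sold) :
    belief n (k + 1) (h.extend p true) = if threshold n k h p < beliefTop n h then
      volume[|Set.Icc (threshold n k h p : ℝ) (beliefTop n h)] else Measure.dirac 1 := by
  simp [belief, hs]

lemma belief_of_not_sold (hs : ¬ h.Sold) :
    belief n k h = volume[|Set.Icc (0 : ℝ) (beliefTop n h)] := by
  induction h using Hist.induction with
  | root => simp [belief]
  | extend k h p b _ =>
    simp only [Hist.sold_extend, not_or, Bool.not_eq_true] at hs
    simp [belief, hs.1, hs.2]

lemma belief_root : belief n 0 Hist.root = unif := by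
  simp [belief, ProbabilityTheory.cond, unif]

variable (h) in
instance isProbabilityMeasure_belief : IsProbabilityMeasure (belief n k h) := by
  induction h using Hist.induction with
  | root => exact isProbabilityMeasure_cond_Icc one_pos
  | extend k h p b ih =>
    by_cases hs : h.Sold
    · rwa [belief_extend_of_sold n p b hs]
    cases b with
    | false =>
      rw [belief_of_not_sold n (by simp [hs])]
      exact isProbabilityMeasure_cond_Icc (beliefTop_pos n _)
    | true =>
      rw [belief_extend_true n p hs]
      split_ifs with h_lt
      · exact isProbabilityMeasure_cond_Icc h_lt
      · infer_instance

variable (h) in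
lemma ae_belief_mem_Icc : ∀ᵐ v ∂belief n k h, v ∈ Set.Icc 0 1 := by
  have h_cond {k : ℕ} (h : Hist k) (a : ℝ≥0) :
      ∀ᵐ v ∂volume[|Set.Icc (a : ℝ) (beliefTop n h)], v ∈ Set.Icc 0 1 :=
    ae_cond_of_forall_mem measurableSet_Icc fun v hv =>
      ⟨a.coe_nonneg.trans hv.1, hv.2.trans (beliefTop_le_one n h)⟩
  induction h using Hist.induction with
  | root => exact ae_cond_mem measurableSet_Icc
  | extend k h p b ih =>
    by_cases hs : h.Sold
    · rwa [belief_extend_of_sold n p b hs]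
    cases b with
    | false =>
      rw [belief_of_not_sold n (by simp [hs])]
      exact h_cond _ 0
    | true =>
      rw [belief_extend_true n p hs]
      split_ifs with h_lt
      · exact h_cond h _
      · simp [ae_dirac_eq]

lemma ae_belief_priceCap_le (hs : h.Sold) :
    ∀ᵐ v ∂belief n k h, (h.priceCap 1 : ℝ) ≤ v := by
  induction h using Hist.induction with
  | root => exact absurd hs Hist.not_sold_root
  | extend k h p b ih =>
    by_cases hs' : h.Sold
    · rw [belief_extend_of_sold n p b hs']
      filter_upwards [ih hs'] with v hv
      exact (NNReal.coe_le_coe.2 (h.priceCap_extend_le p b 1)).trans hv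
    obtain rfl : b = true := ((h.sold_extend p b).1 hs).resolve_left hs'
    rw [belief_extend_true n p hs']
    split_ifs with h_lt
    · refine ae_cond_of_forall_mem measurableSet_Icc fun v hv => le_trans ?_ hv.1
      rw [NNReal.coe_le_coe, Hist.priceCap_extend_true]
      exact (min_le_right _ _).trans (le_threshold n h p)
    · rw [ae_dirac_eq]
      exact NNReal.coe_le_coe.2 ((h.extend p true).priceCap_le 1)

/-- After a sale the reaction to an allowed price `p` reveals nothing: all types in the support
accept if `p ≤ 1`, and all reject otherwise. -/
lemma cond_belief_of_sold (hs : h.Sold) (hp : Allowed h p) {s : Set ℝ}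
    (h_reaction : s = Set.Ici (threshold n k h p : ℝ) ∨ s = Set.Iio (threshold n k h p : ℝ))
    (h_pos : belief n k h s ≠ 0) : (belief n k h)[|s] = belief n k h := by
  suffices h_certain : (∀ᵐ v ∂belief n k h, v ∈ s) ∨ ∀ᵐ v ∂belief n k h, v ∉ s from
    cond_eq_self_of_ae_mem
      (h_certain.resolve_right fun h_null => h_pos (measure_eq_zero_iff_ae_notMem.2 h_null))
  rw [threshold, if_pos hs] at h_reaction
  rcases le_or_gt p 1 with hp_one | hp_one
  · have h_accept : ∀ᵐ v ∂belief n k h, (p : ℝ) ≤ v := by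
      filter_upwards [ae_belief_priceCap_le n hs] with v hv
      exact (NNReal.coe_le_coe.2 ((h.le_priceCap_iff 1).2 ⟨hp_one, hp⟩)).trans hv
    rcases h_reaction with rfl | rfl
    · exact Or.inl h_accept
    · exact Or.inr (h_accept.mono fun v hv => not_lt.2 hv)
  · have h_reject : ∀ᵐ v ∂belief n k h, v < (p : ℝ) :=
      (ae_belief_mem_Icc n h).mono fun v hv => hv.2.trans_lt hp_one
    rcases h_reaction with rfl | rfl
    · exact Or.inr (h_reject.mono fun v hv => not_le.2 hv)
    · exact Or.inl h_reject

lemma belief_accept (hp : Allowed h p)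
    (h_pos : belief n k h (Set.Ici (threshold n k h p : ℝ)) ≠ 0) :
    belief n (k + 1) (h.extend p true) = (belief n k h)[|Set.Ici (threshold n k h p : ℝ)] := by
  by_cases hs : h.Sold
  · rw [belief_extend_of_sold n p _ hs, cond_belief_of_sold n p hs hp (Or.inl rfl) h_pos]
  · have h_inter : Set.Icc (0 : ℝ) (beliefTop n h) ∩ Set.Ici (threshold n k h p : ℝ) =
        Set.Icc (threshold n k h p : ℝ) (beliefTop n h) := by
      rw [← Set.Ici_inter_Iic, Set.inter_right_comm, Set.Ici_inter_Ici, Set.Ici_inter_Iic,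
        max_eq_right (NNReal.coe_nonneg _)]
    have h_lt : threshold n k h p < beliefTop n h := by
      contrapose! h_pos with h_le
      rw [belief_of_not_sold n hs, cond_apply measurableSet_Icc, h_inter, volume_Icc_coe,
        tsub_eq_zero_of_le h_le, ENNReal.coe_zero, mul_zero]
    rw [belief_extend_true n p hs, if_pos h_lt, belief_of_not_sold n hs,
      cond_Icc_cond measurableSet_Ici, h_inter]

lemma belief_reject (hp : Allowed h p)
    (h_pos : belief n k h (Set.Iio (threshold n k h p : ℝ)) ≠ 0) :
    belief n (k + 1) (h.extend p false) = (belief n k h)[|Set.Iio (threshold n k h p : ℝ)] := by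
  by_cases hs : h.Sold
  · rw [belief_extend_of_sold n p _ hs, cond_belief_of_sold n p hs hp (Or.inr rfl) h_pos]
  · have h_threshold : threshold n k h p = indifferentType (n - (k + 1)) (beliefTop n h) p :=
      if_neg hs
    have hp_ne : p ≠ 0 := by
      rintro rfl
      refine h_pos (measure_eq_zero_iff_ae_notMem.2 ?_)
      filter_upwards [ae_belief_mem_Icc n h] with v hv
      simpa [h_threshold] using hv.1
    rw [belief_of_not_sold n (by simp [hs] : ¬ (h.extend p false).Sold), belief_of_not_sold n hs,
      cond_Icc_cond measurableSet_Iio, beliefTop_extend, nextTop_of_ne_zero _ _ hp_ne, h_threshold,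
      NNReal.coe_min]
    exact (cond_congr_set (Icc_inter_Iio_ae_eq _ _)).symm

lemma bayes_belief (hp : Allowed h p) (h_pos : ∫⁻ v, (buyer n).prob b v h p ∂belief n k h ≠ 0) :
    belief n (k + 1) (h.extend p b) = (∫⁻ v, (buyer n).prob b v h p ∂belief n k h)⁻¹ •
      (belief n k h).withDensity fun v => (buyer n).prob b v h p := by
  cases b with
  | true =>
    rw [(isThreshold_buyer n).prob_true] at h_pos ⊢
    rw [lintegral_indicator_one measurableSet_Ici] at h_pos
    rw [inv_lintegral_smul_withDensity_indicator _ measurableSet_Ici, belief_accept n p hp h_pos]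
  | false =>
    rw [(isThreshold_buyer n).prob_false] at h_pos ⊢
    rw [lintegral_indicator_one measurableSet_Iio] at h_pos
    rw [inv_lintegral_smul_withDensity_indicator _ measurableSet_Iio, belief_reject n p hp h_pos]

end Beliefs

/-! ### The equilibrium -/

section Equilibrium

variable {n k m : ℕ}

lemma lintegral_belief {h : Hist k} (hs : ¬ h.Sold) (f : ℝ → ℝ≥0∞) :
    ∫⁻ v, f v ∂belief n k h = (volume (Set.Icc (0 : ℝ) (beliefTop n h)))⁻¹ *
      ∫⁻ v in Set.Icc (0 : ℝ) (beliefTop n h), f v := by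
  rw [belief_of_not_sold n hs, ProbabilityTheory.cond, lintegral_smul_measure, smul_eq_mul]

lemma ae_belief_mem_Icc_priceCap {h : Hist k} (hs : h.Sold) :
    ∀ᵐ v ∂belief n k h, v ∈ Set.Icc (h.priceCap 1 : ℝ) 1 := by
  filter_upwards [ae_belief_priceCap_le n hs, ae_belief_mem_Icc n h] with v h_cap hv
  exact ⟨h_cap, hv.2⟩

lemma sellerUtility_le_seller (S : SellerStrategy) (hn : n = k + m) (h : Hist k) :
    sellerUtility S (buyer n) (belief n k h) m h ≤
      sellerUtility (seller n) (buyer n) (belief n k h) m h := by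
  unfold sellerUtility
  by_cases hs : h.Sold
  · exact lintegral_mono_ae ((ae_belief_mem_Icc_priceCap hs).mono fun v hv =>
      total_pay_le_seller S hs hv m)
  · rw [lintegral_belief hs, lintegral_belief hs]
    exact mul_le_mul' le_rfl (lintegral_total_le_seller S hn hs)

lemma respond_pay_le_seller (S : SellerStrategy) {v : ℝ} {h : Hist k} (hs : h.Sold)
    (hv : v ∈ Set.Icc (h.priceCap 1 : ℝ) 1) (m : ℕ) (p : ℝ≥0) :
    respond (buyer n) pay v (total S (buyer n) pay v m) h p ≤
      respond (buyer n) pay v (total (seller n) (buyer n) pay v m) h p := by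
  have h_total (b : Bool) : total S (buyer n) pay v m (h.extend p b) ≤
      total (seller n) (buyer n) pay v m (h.extend p b) :=
    have h_cap := NNReal.coe_le_coe.2 (h.priceCap_extend_le p b 1)
    total_pay_le_seller S (by simp [hs]) ⟨h_cap.trans hv.1, hv.2⟩ m
  unfold respond
  gcongr <;> exact h_total _

lemma sellerUtilityMid_le_seller (S : SellerStrategy) (hn : n = k + 1 + m) (h : Hist k) (p : ℝ≥0) :
    sellerUtilityMid S (buyer n) (belief n k h) m h p ≤
      sellerUtilityMid (seller n) (buyer n) (belief n k h) m h p := by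
  unfold sellerUtilityMid
  by_cases hs : h.Sold
  · exact lintegral_mono_ae ((ae_belief_mem_Icc_priceCap hs).mono fun v hv =>
      respond_pay_le_seller S hs hv m p)
  · rw [lintegral_belief hs, lintegral_belief hs]
    exact mul_le_mul' le_rfl (lintegral_respond_le_seller S m hs p
      (lintegral_total_le_seller S hn (by simp [hs])))

theorem isPBE_seller_buyer (n : ℕ) :
    IsPBE n (Set.Icc 0 1) unif (seller n) (buyer n) (belief n) where
  belief_prob k _ h _ :=
    ⟨inferInstance, measure_eq_zero_iff_ae_notMem.2
      ((ae_belief_mem_Icc n h).mono fun v hv => not_not_intro hv)⟩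
  belief_root := belief_root n
  bayes _ _ _ _ p hp b h_pos := bayes_belief n p b hp h_pos
  seller_opt _ hk h _ S := sellerUtility_le_seller S (by omega) h
  seller_opt_mid _ hk h _ p _ S := sellerUtilityMid_le_seller S (by omega) h p
  buyer_opt _ hk h _ _ hv :=
    (isBuyerValue_value n hv).buyerUtility_le hv.1 (price_seller n) (isThreshold_buyer n)
      (fun _ => le_threshold n) (isOptimalThreshold_threshold n hv) (by omega) h
  buyer_opt_mid _ hk h _ p _ _ hv :=
    (isBuyerValue_value n hv).buyerUtilityMid_le hv.1 (price_seller n) (isThreshold_buyer n)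
      (fun _ => le_threshold n) (isOptimalThreshold_threshold n hv) (by omega) h p

theorem sellerUtility_root (n : ℕ) :
    sellerUtility (seller n) (buyer n) unif n Hist.root = revenue n := by
  simpa [sellerUtility, unif] using
    lintegral_total_seller (zero_add n).symm Hist.not_sold_root

lemma price_seller_root (n : ℕ) :
    (seller n).price 0 Hist.root = Measure.dirac (equilibriumPrice n 1) := by
  simp [price_seller, offer]

lemma threshold_root (m : ℕ) :
    threshold (m + 1) 0 Hist.root (equilibriumPrice (m + 1) 1) = cutoff m := by
  simp [threshold, indifferentType_equilibriumPrice]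

end Equilibrium

/-! ### Sequences with increments `a + b / x` -/

section LinearGrowth

variable {a b : ℝ} {x : ℕ → ℝ}

lemma abs_sub_log_one_add_le {u : ℝ} (hu : 0 ≤ u) : |u - Real.log (1 + u)| ≤ u ^ 2 / 2 := by
  have h_upper : Real.log (1 + u) ≤ u := by
    linarith [Real.log_le_sub_one_of_pos (by positivity : 0 < 1 + u)]
  have h_lower : u - u ^ 2 / 2 ≤ Real.log (1 + u) := by
    refine le_trans ?_ (Real.le_log_one_add_of_nonneg hu)
    rw [le_div_iff₀ (by positivity)]
    nlinarith [pow_nonneg hu 3]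
  rw [abs_of_nonneg (sub_nonneg.2 h_upper)]
  linarith

lemma add_nat_mul_le (hx0 : 0 < x 0) (ha : 0 ≤ a) (hb : 0 ≤ b)
    (hx : ∀ n, x (n + 1) = x n + a + b / x n) (n : ℕ) : x 0 + n * a ≤ x n := by
  induction n with
  | zero => simp
  | succ n ih =>
    have h_pos : 0 < x n := lt_of_lt_of_le (by positivity) ih
    have h_step : 0 ≤ b / x n := by positivity
    rw [hx]
    push_cast
    linarith

lemma le_apply (hx0 : 0 < x 0) (ha : 0 ≤ a) (hb : 0 ≤ b)
    (hx : ∀ n, x (n + 1) = x n + a + b / x n) (n : ℕ) : x 0 ≤ x n :=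
  (le_add_of_nonneg_right (by positivity)).trans (add_nat_mul_le hx0 ha hb hx n)

lemma le_add_nat_mul (hx0 : 0 < x 0) (ha : 0 ≤ a) (hb : 0 ≤ b)
    (hx : ∀ n, x (n + 1) = x n + a + b / x n) (n : ℕ) : x n ≤ x 0 + n * (a + b / x 0) := by
  induction n with
  | zero => simp
  | succ n ih =>
    have h_step : b / x n ≤ b / x 0 := by
      gcongr
      exact le_apply hx0 ha hb hx n
    rw [hx]
    push_cast
    linarith

lemma abs_sub_log_increment_le {y c : ℝ} (hy : 0 < y) (ha : 0 < a) (hb : 0 ≤ b)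
    (hc : a + b / y ≤ c) :
    |b / y - b / a * (Real.log (y + a + b / y) - Real.log y)| ≤
      (b ^ 2 / a + b / a * (c ^ 2 / 2)) * (y ^ 2)⁻¹ := by
  set u := (a + b / y) / y with hu
  have hu_nonneg : 0 ≤ u := by positivity
  have h_log : Real.log (y + a + b / y) - Real.log y = Real.log (1 + u) := by
    have h_ratio : y + a + b / y = y * (1 + u) := by
      rw [hu]
      field_simp
      ring
    rw [h_ratio, Real.log_mul hy.ne' (by positivity)]
    ring
  have h_second_order : b / y - b / a * Real.log (1 + u) =
      b / a * (u - Real.log (1 + u)) - b ^ 2 / a * (y ^ 2)⁻¹ := by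
    rw [hu]
    field_simp
    ring
  rw [h_log, h_second_order]
  calc |b / a * (u - Real.log (1 + u)) - b ^ 2 / a * (y ^ 2)⁻¹|
      ≤ b / a * |u - Real.log (1 + u)| + b ^ 2 / a * (y ^ 2)⁻¹ := by
        refine (abs_sub _ _).trans_eq ?_
        rw [abs_mul, abs_of_nonneg (by positivity : 0 ≤ b / a),
          abs_of_nonneg (by positivity : 0 ≤ b ^ 2 / a * (y ^ 2)⁻¹)]
    _ ≤ b / a * ((c / y) ^ 2 / 2) + b ^ 2 / a * (y ^ 2)⁻¹ := by
        have hu_le : u ≤ c / y := by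
          rw [hu]
          gcongr
        gcongr
        exact (abs_sub_log_one_add_le hu_nonneg).trans (by gcongr)
    _ = (b ^ 2 / a + b / a * (c ^ 2 / 2)) * (y ^ 2)⁻¹ := by ring

lemma inv_sq_le_one_div_sub_one_div {y y₀ c : ℝ} (hy₀ : 0 < y₀) (hy : y₀ ≤ y) (ha : 0 < a)
    (hb : 0 ≤ b) (hc : a + b / y ≤ c) :
    (y ^ 2)⁻¹ ≤ (1 + c / y₀) / a * (1 / y - 1 / (y + a + b / y)) := by
  have hy_pos : 0 < y := hy₀.trans_le hy
  have hd : a ≤ a + b / y := le_add_of_nonneg_right (by positivity)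
  have hc_pos : 0 < c := ha.trans_le (hd.trans hc)
  have h_gap : 1 / y - 1 / (y + a + b / y) = (a + b / y) / (y * (y + (a + b / y))) := by
    rw [add_assoc, div_sub_div _ _ hy_pos.ne' (by positivity)]
    ring
  calc (y ^ 2)⁻¹ = (1 + (a + b / y) / y) / a * (a / (y * (y + (a + b / y)))) := by
        have h_ne : y + (a + b / y) ≠ 0 := by positivity
        rw [one_add_div hy_pos.ne']
        generalize a + b / y = d at h_ne
        field_simp
    _ ≤ (1 + c / y₀) / a * ((a + b / y) / (y * (y + (a + b / y)))) := by gcongr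
    _ = _ := by rw [h_gap]

/-- The first-order terms of the increment of `x n - a * n - b / a * log (x n)` cancel. The rest
is `O((x n)⁻²)`, hence at most a multiple of `1 / x n - 1 / x (n + 1)`, which telescopes. -/
lemma exists_abs_log_increment_le (hx0 : 0 < x 0) (ha : 0 < a) (hb : 0 ≤ b)
    (hx : ∀ n, x (n + 1) = x n + a + b / x n) :
    ∃ M, 0 ≤ M ∧ ∀ n, |x (n + 1) - x n - a - b / a * (Real.log (x (n + 1)) - Real.log (x n))| ≤
      M * (1 / x n - 1 / x (n + 1)) := by
  let c := a + b / x 0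
  let D := b ^ 2 / a + b / a * (c ^ 2 / 2)
  have hD : 0 ≤ D := by positivity
  refine ⟨D * ((1 + c / x 0) / a), by positivity, fun n => ?_⟩
  have h_ge : x 0 ≤ x n := le_apply hx0 ha.le hb hx n
  have h_pos : 0 < x n := hx0.trans_le h_ge
  have h_step : a + b / x n ≤ c := by
    unfold c
    gcongr
  have h_increment : x (n + 1) - x n - a = b / x n := by
    rw [hx]
    ring
  rw [h_increment, mul_assoc, hx]
  calc _ ≤ D * (x n ^ 2)⁻¹ := abs_sub_log_increment_le h_pos ha hb h_step
    _ ≤ _ := mul_le_mul_of_nonneg_left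
      (inv_sq_le_one_div_sub_one_div hx0 h_ge ha hb h_step) hD

/-- `x n` is of the order of `n`, so that `log (x n)` may be replaced by `log n`. -/
lemma abs_log_sub_log_le (hx0 : 0 < x 0) (ha : 0 < a) (hb : 0 ≤ b)
    (hx : ∀ n, x (n + 1) = x n + a + b / x n) {n : ℕ} (hn : 1 ≤ n) :
    |Real.log (x n) - Real.log n| ≤ |Real.log a| + |Real.log (x 0 + (a + b / x 0))| := by
  have hn_one : (1 : ℝ) ≤ n := mod_cast hn
  have h_lower : n * a ≤ x n :=
    (le_add_of_nonneg_left hx0.le).trans (add_nat_mul_le hx0 ha.le hb hx n)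
  have h_upper : x n ≤ n * (x 0 + (a + b / x 0)) := by
    refine (le_add_nat_mul hx0 ha.le hb hx n).trans ?_
    linarith [le_mul_of_one_le_left hx0.le hn_one]
  have h_pos : 0 < n * a := by positivity
  have h_log_lower := Real.log_le_log h_pos h_lower
  have h_log_upper := Real.log_le_log (h_pos.trans_le h_lower) h_upper
  rw [Real.log_mul (by positivity) (by positivity)] at h_log_lower h_log_upper
  rw [abs_le]
  constructor
  · linarith [neg_abs_le (Real.log a), abs_nonneg (Real.log (x 0 + (a + b / x 0)))]
  · linarith [le_abs_self (Real.log (x 0 + (a + b / x 0))), abs_nonneg (Real.log a)]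

theorem exists_abs_sub_log_le (hx0 : 0 < x 0) (ha : 0 < a) (hb : 0 ≤ b)
    (hx : ∀ n, x (n + 1) = x n + a + b / x n) :
    ∃ C, ∀ n : ℕ, 1 ≤ n → |x n - a * n - b / a * Real.log n| ≤ C := by
  obtain ⟨M, hM, h_step⟩ := exists_abs_log_increment_le hx0 ha hb hx
  set z : ℕ → ℝ := fun n => x n - a * n - b / a * Real.log (x n) with hz
  have h_drift (n : ℕ) : |z n - z 0| ≤ M * (1 / x 0 - 1 / x n) := by
    induction n with
    | zero => simp
    | succ n ih =>
      calc |z (n + 1) - z 0| ≤ |z (n + 1) - z n| + |z n - z 0| := abs_sub_le _ _ _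
        _ ≤ M * (1 / x n - 1 / x (n + 1)) + M * (1 / x 0 - 1 / x n) := by
          refine add_le_add ((congrArg abs ?_).trans_le (h_step n)) ih
          simp only [hz]
          push_cast
          ring
        _ = M * (1 / x 0 - 1 / x (n + 1)) := by ring
  refine ⟨|z 0| + M * (1 / x 0) +
    b / a * (|Real.log a| + |Real.log (x 0 + (a + b / x 0))|), fun n hn => ?_⟩
  have h_pos : 0 < x n :=
    lt_of_lt_of_le (by positivity) (add_nat_mul_le hx0 ha.le hb hx n)
  calc |x n - a * n - b / a * Real.log n|
      = |z 0 + (z n - z 0) + b / a * (Real.log (x n) - Real.log n)| := by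
        congr 1
        simp only [hz]
        ring
    _ ≤ |z 0| + |z n - z 0| + |b / a * (Real.log (x n) - Real.log n)| := abs_add_three _ _ _
    _ ≤ _ := by
      rw [abs_mul, abs_of_nonneg (by positivity : 0 ≤ b / a)]
      gcongr
      · exact (h_drift n).trans (by gcongr; exact sub_le_self _ (by positivity))
      · exact abs_log_sub_log_le hx0 ha hb hx hn

theorem isEquivalent_const_mul_nat (hx0 : 0 < x 0) (ha : 0 < a) (hb : 0 ≤ b)
    (hx : ∀ n, x (n + 1) = x n + a + b / x n) :
    x ~[atTop] fun n => a * (n : ℝ) := by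
  obtain ⟨C, hC⟩ := exists_abs_sub_log_le hx0 ha hb hx
  have h_bounded : (fun n : ℕ => x n - a * n - b / a * Real.log n) =O[atTop] fun _ => (1 : ℝ) := by
    refine IsBigO.of_bound C ?_
    filter_upwards [eventually_ge_atTop 1] with n hn
    simpa using hC n hn
  have h_const : (fun _ : ℕ => (1 : ℝ)) =o[atTop] fun n : ℕ => (n : ℝ) :=
    isLittleO_const_left.2 (Or.inr (tendsto_norm_atTop_atTop.comp tendsto_natCast_atTop_atTop))
  have h_error : (fun n : ℕ => x n - a * n - b / a * Real.log n) =o[atTop] fun n : ℕ => (n : ℝ) :=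
    h_bounded.trans_isLittleO h_const
  have h_log : (fun n : ℕ => b / a * Real.log n) =o[atTop] fun n : ℕ => (n : ℝ) :=
    (Real.isLittleO_log_id_atTop.comp_tendsto tendsto_natCast_atTop_atTop).const_mul_left _
  refine IsLittleO.isEquivalent ?_
  exact (h_error.add h_log).const_mul_right ha.ne' |>.congr_left fun n => by simp

end LinearGrowth

/-! ### Asymptotics of the equilibrium -/

section RevenueAsymptotics

lemma isEquivalent_sqrt {α : Type*} {l : Filter α} {u v : α → ℝ} (hv : 0 ≤ v) (h : u ~[l] v) :
    (fun x => √(u x)) ~[l] fun x => √(v x) := by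
  simp only [Real.sqrt_eq_rpow]
  exact h.rpow hv

lemma sq_one_add_revenue_succ (n : ℕ) :
    (1 + (revenue (n + 1) : ℝ)) ^ 2 =
      (1 + revenue n : ℝ) ^ 2 + 1 / 2 + 1 / 16 / (1 + revenue n : ℝ) ^ 2 := by
  rw [one_add_revenue_succ]
  field_simp
  ring

theorem exists_abs_sq_one_add_revenue_sub_le :
    ∃ C, ∀ n : ℕ, 1 ≤ n → |(1 + (revenue n : ℝ)) ^ 2 - n / 2 - Real.log n / 8| ≤ C := by
  obtain ⟨C, hC⟩ := exists_abs_sub_log_le (x := fun n => (1 + (revenue n : ℝ)) ^ 2)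
    (by positivity) (by norm_num) (by norm_num) sq_one_add_revenue_succ
  refine ⟨C, fun n hn => ?_⟩
  convert hC n hn using 2
  ring

theorem isEquivalent_one_add_revenue :
    (fun n => 1 + (revenue n : ℝ)) ~[atTop] fun n => √((n : ℝ) / 2) := by
  have h_sq := isEquivalent_const_mul_nat (x := fun n => (1 + (revenue n : ℝ)) ^ 2)
    (by positivity) (by norm_num) (by norm_num) sq_one_add_revenue_succ
  convert isEquivalent_sqrt (fun n => by positivity) h_sq using 2 with n n
  · rw [Real.sqrt_sq (by positivity)]
  · ring_nf

lemma tendsto_sqrt_half_atTop : Tendsto (fun n : ℕ => √((n : ℝ) / 2)) atTop atTop :=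
  Real.tendsto_sqrt_atTop.comp (tendsto_natCast_atTop_atTop.atTop_div_const two_pos)

theorem isEquivalent_equilibriumPrice :
    (fun n => (equilibriumPrice n 1 : ℝ)) ~[atTop] fun n : ℕ => √(2 / (n : ℝ)) := by
  have h_revenue : (fun n => (revenue n : ℝ)) ~[atTop] fun n => √((n : ℝ) / 2) := by
    simpa using isEquivalent_one_add_revenue.add_const_of_norm_tendsto_atTop (c := -1)
      (tendsto_norm_atTop_atTop.comp tendsto_sqrt_half_atTop)
  refine ((IsEquivalent.refl (u := fun n : ℕ => 2 / (n : ℝ))).mul h_revenue).congr_left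
    (Eventually.of_forall fun n => ?_) |>.congr_right (Eventually.of_forall fun n => ?_)
  · simp only [equilibriumPrice, Pi.mul_apply]
    push_cast
    ring
  · rw [Pi.mul_apply, ← Real.sqrt_sq (by positivity : 0 ≤ 2 / (n : ℝ)),
      ← Real.sqrt_mul (by positivity)]
    rcases eq_or_ne n 0 with rfl | hn
    · simp
    · congr 1
      field_simp

theorem isEquivalent_one_sub_cutoff :
    (fun m => 1 - (cutoff m : ℝ)) ~[atTop] fun m : ℕ => 1 / √(2 * ((m + 1 : ℕ) : ℝ)) := by
  have h_succ : (fun m : ℕ => (m : ℝ) / 2) ~[atTop] fun m : ℕ => ((m : ℝ) + 1) / 2 :=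
    (IsEquivalent.refl.add_const_of_norm_tendsto_atTop (c := (1 : ℝ))
      (tendsto_norm_atTop_atTop.comp tendsto_natCast_atTop_atTop)).symm.div IsEquivalent.refl
  have h_revenue : (fun m => 1 + (revenue m : ℝ)) ~[atTop] fun m => √(((m : ℝ) + 1) / 2) :=
    isEquivalent_one_add_revenue.trans (isEquivalent_sqrt (fun m => by positivity) h_succ)
  refine ((IsEquivalent.refl (u := fun _ : ℕ => (1 / 2 : ℝ))).div h_revenue).congr_left
    (Eventually.of_forall fun m => ?_) |>.congr_right (Eventually.of_forall fun m => ?_)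
  · simp only [Pi.div_apply, one_sub_cutoff]
    field_simp
  · have h_sqrt : √(2 * ((m + 1 : ℕ) : ℝ)) = 2 * √(((m : ℝ) + 1) / 2) := by
      rw [← Real.sqrt_sq (two_pos.le : (0 : ℝ) ≤ 2), ← Real.sqrt_mul (by positivity)]
      congr 1
      push_cast
      rw [Real.sqrt_sq two_pos.le]
      ring
    simp only [Pi.div_apply, h_sqrt]
    field_simp

theorem isEquivalent_one_sub_threshold_root :
    (fun n => 1 - (threshold n 0 Hist.root (equilibriumPrice n 1) : ℝ)) ~[atTop]
      fun n : ℕ => 1 / √(2 * (n : ℝ)) := by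
  refine (isEquivalent_one_sub_cutoff.comp_tendsto (tendsto_sub_atTop_nat 1)).congr_left ?_
    |>.congr_right ?_
  all_goals
    filter_upwards [eventually_ge_atTop 1] with n hn
    obtain ⟨m, rfl⟩ := Nat.exists_eq_add_of_le' hn
    simp only [Function.comp_apply, Nat.add_sub_cancel, threshold_root]

end RevenueAsymptotics

end RepeatedSales

theorem theorem3 :
    ∃ (S : ℕ → SellerStrategy) (B : ℕ → BuyerStrategy) (μ : ℕ → BeliefSystem)
      (t : ℕ → ∀ k, Hist k → ℝ≥0 → ℝ≥0) (R : ℕ → ℝ) (p : ℕ → ℝ≥0) (e : ℕ → ℝ) (C : ℝ),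
      -- the recursion
      R 0 = 0 ∧ (∀ n : ℕ, 1 ≤ n → R n = (1 + 2 * R (n - 1)) ^ 2 / (4 * (1 + R (n - 1)))) ∧
      -- for every number of rounds, a threshold equilibrium with revenue `R n`
      (∀ n : ℕ, 1 ≤ n →
        IsPBE n (Set.Icc 0 1) unif (S n) (B n) (μ n) ∧
        IsThreshold (B n) (t n) ∧
        sellerUtility (S n) (B n) unif n Hist.root = ENNReal.ofReal (R n) ∧
        -- the asymptotics of the revenue, with a bounded error term `e n`
        |e n| ≤ C ∧
        0 ≤ (n : ℝ) / 2 + Real.log n / 8 + e n ∧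
        R n = √((n : ℝ) / 2 + Real.log n / 8 + e n) - 1 ∧
        -- the price in the first round
        (S n).price 0 Hist.root = Measure.dirac (p n)) ∧
      (fun n => (p n : ℝ)) ~[atTop] (fun n : ℕ => √(2 / (n : ℝ))) ∧
      -- the threshold in the first round, at that price
      (fun n => 1 - (t n 0 Hist.root (p n) : ℝ)) ~[atTop] (fun n : ℕ => 1 / √(2 * (n : ℝ))) := by
  obtain ⟨C, hC⟩ := exists_abs_sq_one_add_revenue_sub_le
  refine ⟨seller, buyer, belief, threshold, fun n => revenue n, fun n => equilibriumPrice n 1,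
    fun n => (1 + (revenue n : ℝ)) ^ 2 - n / 2 - Real.log n / 8, C, ?_, fun n hn => ?_,
    fun n hn => ?_, isEquivalent_equilibriumPrice, isEquivalent_one_sub_threshold_root⟩
  · simp [revenue]
  · obtain ⟨m, rfl⟩ := Nat.exists_eq_add_of_le' hn
    exact coe_revenue_succ m
  · have h_sq : (n : ℝ) / 2 + Real.log n / 8 +
        ((1 + (revenue n : ℝ)) ^ 2 - n / 2 - Real.log n / 8) = (1 + (revenue n : ℝ)) ^ 2 := by
      ring
    refine ⟨isPBE_seller_buyer n, isThreshold_buyer n, ?_, hC n hn, ?_, ?_, price_seller_root n⟩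
    · rw [sellerUtility_root, ENNReal.ofReal_coe_nnreal]
    · rw [h_sq]
      positivity
    · rw [h_sq, Real.sqrt_sq (by positivity), add_sub_cancel_left]
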